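/- Use $\hat f(\xi)=\int_{\mathbb R^n}e^{-ix\cdot\xi}f(x)\,dx$, extended to $L^m(\mathbb R^n)$ for $m\in[1,2]$ in the usual way, and let $\mathcal F^{-1}$ be its inverse. Let $|D|^s$ have symbol $|\xi|^s$ (so $|D|^2=-\Delta$), let $\chi(D)f=\mathcal F^{-1}(\chi\hat f)$, and let $\|f\|_{\dot H^s}=\||D|^sf\|_{L^2}$. For $r\ge 0$ put $A(r;\sigma)=r^2A_0+r^{2\sigma}A_1$ (with $r^0=1$) and $$A_0=\tfrac12\begin{pmatrix}0&-2&-2\\2&0&-2\\1&1&2\end{pmatrix},\quad A_1=\tfrac12\begin{pmatrix}1&1&0\\1&1&0\\0&0&0\end{pmatrix},\quad T_0=\begin{pmatrix}-1&0&1\\1&0&1\\0&1&0\end{pmatrix},$$ $$T_1=I_3+|\xi|^{2-2\sigma}\begin{pmatrix}0&0&1\\0&0&1\\1&1&0\end{pmatrix},\qquad T_{1\frac12}=I_3+|\xi|^{4-4\sigma}\begin{pmatrix}0&0&0\\0&0&1\\0&1&0\end{pmatrix}.$$ Theorem. Let $\sigma\in[0,1)$. There is $\varepsilon_0>0$, depending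 only on $\sigma$, such that $T_0,T_1,T_{1\frac12}$ are invertible for $|\xi|\le\varepsilon_0$ and the following holds. Let $n\ge1$, $0<\varepsilon\le\varepsilon_0$, $m\in[1,2]$, $s\ge0$, and let $\chi_{\mathrm{int}}\in C^\infty(\mathbb R^n)$ be real-valued with support in $\{|\xi|\le\varepsilon\}$. Then there is a constant $C>0$, depending only on $\sigma,n,m,s,\varepsilon$ and $\chi_{\mathrm{int}}$, such that for all data with $(|D|^2u_0,u_1,\theta_0)\in (L^m(\mathbb R^n))^3$ ($u_0$ a tempered distribution) the following is true. Let $w^{(0)}$ be the solution of $$w^{(0)}_t+A(|\xi|;\sigma)w^{(0)}=0\ (t>0),\qquad w^{(0)}(0,\xi)=w^{(0)}_0(\xi):=\left(\hat u_1+|\xi|^2\hat u_0,\ \hat u_1-|\xi|^2\hat u_0,\ \hat\theta_0\right)^{\mathrm T}(\xi),$$ for almost every $\xi\in\mathbb R^n$. This system is the Fourier transform of the system for $\left(u_t+|D|^2u,\,u_t-|D|^2u,\,\theta\right)^{\mathrm T}$, where $(u,\theta)$ solves $u_{tt}+\Delta^2u+\Delta\theta+(-\Delta)^\sigma u_t=0$,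 $\theta_t-\Delta\theta-\Delta u_t=0$ with $(u,u_t,\theta)(0,\cdot)=(u_0,u_1,\theta_0)$. Let $\tilde w$ be the solution, for almost every $\xi$ with $|\xi|\le\varepsilon$, of the Fourier-transformed reference system of $\tilde u_t+\mathrm{diag}\left((-\Delta)^{2-\sigma},-\Delta,(-\Delta)^{\sigma}\right)\tilde u=0$, namely $$\tilde w_t+\mathrm{diag}\left(|\xi|^{4-2\sigma},|\xi|^2,|\xi|^{2\sigma}\right)\tilde w=0\ (t>0),\qquad \tilde w(0,\xi)=T_{1\frac12}^{-1}T_1^{-1}T_0^{-1}w^{(0)}_0(\xi).$$ Then for all $t\ge0$ the function $\chi_{\mathrm{int}}\left(w^{(0)}-T_0T_1T_{1\frac12}\tilde w\right)(t,\cdot)$ is in $L^2(\mathbb R^n)$ and $$\left\|\chi_{\mathrm{int}}(D)\mathcal F^{-1}_{\xi\to x}\left(w^{(0)}-T_0T_1T_{1\frac12}\tilde w\right)(t,\cdot)\right\|_{\dot H^s(\mathbb R^n)}\le C(1+t)^{-\frac{(2-m)n+2ms}{4m(2-\sigma)}-\frac{1-\sigma}{2-\sigma}}\left\|(|D|^2u_0,u_1,\theta_0)\right\|_{(L^m(\mathbb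 R^n))^3}.$$ -/

import Mathlib

open MeasureTheory Set Metric
open scoped FourierTransform SchwartzMap ENNReal ContDiff Laplacian Matrix

noncomputable section

namespace TripleDiffusion

/-- The space `ℝⁿ` with its Euclidean norm. -/
abbrev Rn (n : ℕ) : Type := EuclideanSpace ℝ (Fin n)

/-- The space `ℂ³` with its Hermitian norm. -/
abbrev C3 : Type := EuclideanSpace ℂ (Fin 3)

/-! ### Fourier transform, with the convention `f̂(ξ) = ∫ exp(-i x·ξ) f(x) dx` -/

/-- The part of `f` where `f` is large. It is in `L¹` if `f` is in `L^m`, `m ∈ [1,2]`. -/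
def largePart {n : ℕ} (f : Rn n → ℂ) : Rn n → ℂ := {x | 1 < ‖f x‖}.indicator f

/-- The part of `f` where `f` is bounded by one. It is in `L²` if `f` is in `L^m`, `m ∈ [1,2]`. -/
def smallPart {n : ℕ} (f : Rn n → ℂ) : Rn n → ℂ := {x | ‖f x‖ ≤ 1}.indicator f

theorem largePart_add_smallPart {n : ℕ} (f : Rn n → ℂ) : largePart f + smallPart f = f := by
  funext x
  by_cases h : ‖f x‖ ≤ 1
  · simp [largePart, smallPart, h, not_lt.mpr h]
  · simp [largePart, smallPart, h, not_le.mp h]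

theorem largePart_memLp {n : ℕ} {f : Rn n → ℂ} {m : ℝ} (hm : 1 ≤ m)
    (hf : MemLp f (ENNReal.ofReal m) volume) : MemLp (largePart f) 1 volume := by
  have hm0 : 0 < m := by linarith
  have hint := (integrable_norm_rpow_iff hf.1 (by simp [hm0]) (by simp)).2 hf
  rw [ENNReal.toReal_ofReal hm0.le] at hint
  have hset : NullMeasurableSet {x | 1 < ‖f x‖} (volume : Measure (Rn n)) :=
    nullMeasurableSet_lt aemeasurable_const hf.1.norm.aemeasurable
  refine memLp_one_iff_integrable.2 (hint.mono' (hf.1.indicator₀ hset) (.of_forall fun x => ?_))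
  by_cases h : 1 < ‖f x‖
  · simpa [largePart, h] using Real.rpow_le_rpow_of_exponent_le h.le hm
  · simpa [largePart, h] using Real.rpow_nonneg (norm_nonneg _) _

theorem smallPart_memLp {n : ℕ} {f : Rn n → ℂ} {m : ℝ} (hm : 1 ≤ m) (hm' : m ≤ 2)
    (hf : MemLp f (ENNReal.ofReal m) volume) : MemLp (smallPart f) 2 volume := by
  have hm0 : 0 < m := by linarith
  have hint := (integrable_norm_rpow_iff hf.1 (by simp [hm0]) (by simp)).2 hf
  rw [ENNReal.toReal_ofReal hm0.le] at hint
  have hset : NullMeasurableSet {x | ‖f x‖ ≤ 1} (volume : Measure (Rn n)) :=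
    nullMeasurableSet_le hf.1.norm.aemeasurable aemeasurable_const
  have hmeas := hf.1.indicator₀ hset
  refine (memLp_two_iff_integrable_sq_norm hmeas).2
    (hint.mono' (hmeas.norm.pow 2) (.of_forall fun x => ?_))
  by_cases h : ‖f x‖ ≤ 1
  · have := Real.rpow_le_rpow_of_exponent_ge_of_imp (norm_nonneg (f x)) h hm' (by intros; linarith)
    simpa [h] using this
  · simpa [h] using Real.rpow_nonneg (norm_nonneg _) _

open Classical in
/-- The Fourier transform on `L¹ + L²`, hence on `L^m` with `m ∈ [1,2]`: the Fourier integral of the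
large part of `f` plus the Plancherel transform of its small part. Mathlib's transforms carry the
kernel `exp(-2πi x·ξ)`, so the argument is rescaled to get the kernel `exp(-i x·ξ)`. -/
def fourier {n : ℕ} (f : Rn n → ℂ) (ξ : Rn n) : ℂ :=
  𝓕 (largePart f) ((2 * Real.pi)⁻¹ • ξ) +
    (if h : MemLp (smallPart f) 2 volume then
      (𝓕 (h.toLp (smallPart f)) : Lp (α := Rn n) ℂ 2 volume) ((2 * Real.pi)⁻¹ • ξ) else 0)

theorem memLp_comp_dilation {n : ℕ} {h : Rn n → C3} (hh : MemLp h 2 volume) :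
    MemLp (fun η => h ((2 * Real.pi) • η)) 2 volume := by
  have hpi : (2 * Real.pi) ≠ 0 := by positivity
  refine MemLp.comp_of_map (f := fun η : Rn n => (2 * Real.pi) • η) ?_ (by fun_prop)
  rw [Measure.map_addHaar_smul volume hpi]
  exact hh.smul_measure ENNReal.ofReal_ne_top

/-- The inverse Fourier transform `(2π)⁻ⁿ ∫ exp(i x·ξ) h(ξ) dξ` of `h ∈ L²`: by `ξ = 2π η`, it is
Mathlib's inverse transform of `η ↦ h (2π η)`. -/
def fourierInvL2 {n : ℕ} (h : Rn n → C3) (hh : MemLp h 2 volume) : Lp (α := Rn n) C3 2 volume :=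
  𝓕⁻ ((memLp_comp_dilation hh).toLp (fun η => h ((2 * Real.pi) • η)))

/-- The norm of `f ∈ L²` in the homogeneous Sobolev space, `‖|D|^s f‖_{L²}`, possibly infinite.
In Mathlib's frequency variable `η`, the symbol of `|D|^s` is `|2π η|^s` and Plancherel's theorem
has constant one. -/
def homSobolevNorm {n : ℕ} (s : ℝ) (f : Lp (α := Rn n) C3 2 volume) : ℝ≥0∞ :=
  eLpNorm (fun η => ((2 * Real.pi * ‖η‖) ^ s) • (𝓕 f : Lp (α := Rn n) C3 2 volume) η) 2 volume

/-! ### The system in the frequency space -/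

/-- The coefficient matrix `A₀`. -/
def A₀ : Matrix (Fin 3) (Fin 3) ℂ :=
  (1 / 2 : ℂ) • !![0, -2, -2; 2, 0, -2; 1, 1, 2]

/-- The coefficient matrix `A₁`. -/
def A₁ : Matrix (Fin 3) (Fin 3) ℂ :=
  (1 / 2 : ℂ) • !![1, 1, 0; 1, 1, 0; 0, 0, 0]

/-- `A(r; σ) = r² A₀ + r^{2σ} A₁`. -/
def A (σ r : ℝ) : Matrix (Fin 3) (Fin 3) ℂ :=
  ((r ^ 2 : ℝ) : ℂ) • A₀ + ((r ^ (2 * σ) : ℝ) : ℂ) • A₁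

/-- The first diagonalizer, `T₀`. -/
def T₀ : Matrix (Fin 3) (Fin 3) ℂ := !![-1, 0, 1; 1, 0, 1; 0, 1, 0]

/-- The second diagonalizer, `T₁ = I + N₁`. -/
def T₁ (σ r : ℝ) : Matrix (Fin 3) (Fin 3) ℂ :=
  1 + ((r ^ (2 - 2 * σ) : ℝ) : ℂ) • !![0, 0, 1; 0, 0, 1; 1, 1, 0]

/-- The third diagonalizer, `T_{1½} = I + N_{1½}`. -/
def T₁half (σ r : ℝ) : Matrix (Fin 3) (Fin 3) ℂ :=
  1 + ((r ^ (4 - 4 * σ) : ℝ) : ℂ) • !![0, 0, 0; 0, 0, 1; 0, 1, 0]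

/-- The symbol of the reference operator `diag((-Δ)^{2-σ}, -Δ, (-Δ)^σ)`. -/
def refSymbol (σ r : ℝ) : Matrix (Fin 3) (Fin 3) ℂ :=
  Matrix.diagonal ![((r ^ (4 - 2 * σ) : ℝ) : ℂ), ((r ^ 2 : ℝ) : ℂ), ((r ^ (2 * σ) : ℝ) : ℂ)]

/-- `w` solves `w_t + B(ξ) w = 0` for `t > 0`, `w(0, ξ) = w₀(ξ)`, for almost every `ξ ∈ Z`. -/
def SolvesCauchy {n : ℕ} (Z : Set (Rn n)) (B : Rn n → Matrix (Fin 3) (Fin 3) ℂ)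
    (w₀ : Rn n → Fin 3 → ℂ) (w : ℝ → Rn n → Fin 3 → ℂ) : Prop :=
  ∀ᵐ ξ : Rn n, ξ ∈ Z →
    w 0 ξ = w₀ ξ ∧ ContinuousOn (fun t => w t ξ) (Ici 0) ∧
      ∀ t : ℝ, 0 < t → HasDerivAt (fun τ => w τ ξ) (-(B ξ *ᵥ w t ξ)) t

/-- `v = |D|² u = -Δ u`, where `u` is a tempered distribution and `v` is a function. -/
def IsAbsDSq {n : ℕ} (u : 𝓢'(Rn n, ℂ)) (v : Rn n → ℂ) : Prop :=
  ∀ φ : 𝓢(Rn n, ℂ), (-Δ u) φ = ∫ x, φ x * v x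

/-- The initial datum `(û₁ + |ξ|² û₀, û₁ - |ξ|² û₀, θ̂₀)`, where `v = |D|² u₀`, so that
`v̂ = |ξ|² û₀`. -/
def initialDatum {n : ℕ} (v u₁ θ₀ : Rn n → ℂ) (ξ : Rn n) : Fin 3 → ℂ :=
  ![fourier u₁ ξ + fourier v ξ, fourier u₁ ξ - fourier v ξ, fourier θ₀ ξ]

/-- The initial datum `T_{1½}⁻¹ T₁⁻¹ T₀⁻¹ w₀(ξ)` of the reference system. -/
def refDatum {n : ℕ} (σ : ℝ) (w₀ : Rn n → Fin 3 → ℂ) (ξ : Rn n) : Fin 3 → ℂ :=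
  ((T₁half σ ‖ξ‖)⁻¹ * (T₁ σ ‖ξ‖)⁻¹ * T₀⁻¹) *ᵥ w₀ ξ

/-- `χ(ξ) (w - T₀ T₁ T_{1½} w')(t, ξ)`. -/
def cutDifference {n : ℕ} (σ : ℝ) (χ : Rn n → ℝ) (w w' : ℝ → Rn n → Fin 3 → ℂ) (t : ℝ)
    (ξ : Rn n) : C3 :=
  WithLp.toLp 2
    ((χ ξ : ℂ) • (w t ξ - (T₀ * T₁ σ ‖ξ‖ * T₁half σ ‖ξ‖) *ᵥ w' t ξ))

end TripleDiffusion

end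

/-! ### Diagonalization of `A₁ + δ A₀` for small `δ` -/

namespace TripleDiffusion

/-! With `δ = r^(2-2σ)`, the symbol is `r^(2σ)(A₁ + δ A₀)`, so for fixed `r > 0` everything reduces
to one small parameter `δ` and the rescaled time `τ = t r^(2σ)`. Conjugation by `T₀` gives
`conjSymbol δ`, whose eigenvalues are `δ²`, `δ`, `1` up to a relative error `O(δ)`. Its exact
eigenvector matrix `S`, normalised to have diagonal one, is `1 + O(δ)`, and so is `T = T₁ T_{1½}`.
Hence `S exp(-τ diag(a,b,c)) S⁻¹` and `T exp(-τ diag(δ²,δ,1)) T⁻¹` differ by `O(δ) exp(-τδ²/2)`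
(`norm_exp_conjSymbol_sub_le`). Of `T₁` and `T_{1½}` only their distance to the identity enters.

In the original variables the difference of the propagators is at most a constant times `r^(2-2σ)
exp(-t r^(4-2σ)/2)` (`norm_propagatorDiff_le`). The factor `r^(2-2σ)` yields the extra decay
`(1+t)^(-(1-σ)/(2-σ))`.

The passage from `L^m` to `L²` avoids the Hausdorff–Young inequality. With `p = 4-2σ` and `L =
(1+t)^(1/p)`, the multiplier is dominated by a power of `1+t` times a fixed weight, in `L²` and
bounded by one, evaluated at `Lξ` (`exists_symbol_le`). Splitting `f` at a height adapted to `L`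
gives `‖weight(L·) f̂‖₂ ≤ C L^(-n(2-m)/(2m)) ‖f‖_m` (`exists_eLpNorm_weight_mul_fourier_le`).
Uniqueness for the linear system turns arbitrary solutions into matrix exponentials
(`eq_exp_mulVec_of_hasDerivAt`). -/

/-- A constant times the characteristic polynomial of `A₁ + δ A₀`. -/
def charCubic (δ x : ℝ) : ℝ := x * (x - δ) * (x - 1) + δ ^ 2 * (2 * x - δ)

theorem continuous_charCubic (δ : ℝ) : Continuous (charCubic δ) := by
  unfold charCubic; fun_prop

/-- To leading order the equation is `δ x = δ³`; the next term is `-δ³`, so a margin of `3δ³` leaves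
room for a sign change. -/
theorem exists_charCubic_root_near_sq {δ : ℝ} (h0 : 0 < δ) (h1 : δ ≤ 1 / 16) :
    ∃ x ∈ Icc (δ ^ 2 - 3 * δ ^ 3) (δ ^ 2), charCubic δ x = 0 := by
  refine intermediate_value_Icc (by nlinarith [pow_pos h0 3]) (continuous_charCubic δ).continuousOn
    ⟨?_, ?_⟩
  -- The bracket is grouped into two nonnegative pieces, the first being `2δ + 9δ³`.
  · have key : charCubic δ (δ ^ 2 - 3 * δ ^ 3) = -(δ ^ 3 * (3 * δ - δ * (1 - (3 * δ) ^ 2) +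
        δ ^ 2 * (1 - 3 * δ) ^ 2 * (1 - δ * (1 - 3 * δ)))) := by unfold charCubic; ring
    have h2 : 0 ≤ 3 * δ - δ * (1 - (3 * δ) ^ 2) := by nlinarith [pow_pos h0 3]
    have h3 : 0 ≤ 1 - δ * (1 - 3 * δ) := by nlinarith
    rw [key, neg_nonpos]
    positivity
  · have : charCubic δ (δ ^ 2) = δ ^ 4 * (1 - δ + δ ^ 2) := by unfold charCubic; ring
    rw [this]; have : 0 ≤ 1 - δ + δ ^ 2 := by nlinarith
    positivity

/-- With `x = δ + y`, the leading balance is `δ y = δ³`, so `y` is close to `δ²`. -/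
theorem exists_charCubic_root_near_self {δ : ℝ} (h0 : 0 < δ) (h1 : δ ≤ 1 / 16) :
    ∃ x ∈ Icc δ (δ + 2 * δ ^ 2), charCubic δ x = 0 := by
  refine intermediate_value_Icc' (by nlinarith [pow_pos h0 3]) (continuous_charCubic δ).continuousOn
    ⟨?_, ?_⟩
  · have : charCubic δ (δ + 2 * δ ^ 2) = -(δ ^ 3 * (1 - 2 * δ * (1 + 2 * δ) ^ 2)) := by
      unfold charCubic; ring
    rw [this]; have : 0 ≤ 1 - 2 * δ * (1 + 2 * δ) ^ 2 := by
      have : (1 + 2 * δ) ^ 2 ≤ 4 := by nlinarith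
      nlinarith
    have : 0 ≤ δ ^ 3 * (1 - 2 * δ * (1 + 2 * δ) ^ 2) := by positivity
    linarith
  · have : charCubic δ δ = δ ^ 3 := by unfold charCubic; ring
    rw [this]; positivity

theorem exists_charCubic_root_near_one {δ : ℝ} (h0 : 0 < δ) (h1 : δ ≤ 1 / 16) :
    ∃ x ∈ Icc (1 - δ) 1, charCubic δ x = 0 := by
  refine intermediate_value_Icc (by linarith) (continuous_charCubic δ).continuousOn ⟨?_, ?_⟩
  · have : charCubic δ (1 - δ) = -(δ * (1 - 5 * δ + 5 * δ ^ 2)) := by unfold charCubic; ring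
    rw [this]
    have : 0 ≤ δ * (1 - 5 * δ + 5 * δ ^ 2) := mul_nonneg h0.le (by nlinarith)
    linarith
  · have : charCubic δ 1 = δ ^ 2 * (2 - δ) := by unfold charCubic; ring
    rw [this]; exact mul_nonneg (sq_nonneg _) (by linarith)

/-! ### Exact diagonalization and comparison of the exponentials -/

open scoped Matrix.Norms.Operator

/-- The conjugate of `A₁ + δ A₀` under `T₀`. -/
def conjSymbol (δ : ℝ) : Matrix (Fin 3) (Fin 3) ℂ :=
  !![0, 0, (δ : ℂ); 0, (δ : ℂ), (δ : ℂ); -(δ : ℂ), -(δ : ℂ), 1]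

theorem T₀_mul_inv : T₀ * !![-(1 / 2), 1 / 2, 0; 0, 0, 1; 1 / 2, 1 / 2, 0] = 1 := by
  ext i j
  fin_cases i <;> fin_cases j <;>
    simp [T₀, Matrix.mul_apply, Fin.sum_univ_three] <;> norm_num

theorem isUnit_T₀ : IsUnit T₀ := IsUnit.of_mul_eq_one _ T₀_mul_inv

theorem symbol_mul_T₀ (δ : ℝ) : (A₁ + (δ : ℂ) • A₀) * T₀ = T₀ * conjSymbol δ := by
  ext i j
  fin_cases i <;> fin_cases j <;>
    simp [T₀, A₀, A₁, conjSymbol, Matrix.mul_apply, Fin.sum_univ_three] <;> ring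

theorem linfty_opNorm_le_of_row_sum_le {B : Matrix (Fin 3) (Fin 3) ℂ} {C : ℝ}
    (h : ∀ i, ‖B i 0‖ + ‖B i 1‖ + ‖B i 2‖ ≤ C) : ‖B‖ ≤ C := by
  have hC : 0 ≤ C := le_trans (by positivity) (h 0)
  lift C to NNReal using hC
  rw [Matrix.linfty_opNorm_def]
  norm_cast
  refine Finset.sup_le fun i _ => ?_
  have := h i
  rw [Fin.sum_univ_three]
  exact_mod_cast this

/-- Neumann series for invertibility. Then `B⁻¹ - 1 = B⁻¹(1 - B)` gives `‖B⁻¹‖ ≤ η‖B⁻¹‖ + 1`, and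
the last term is absorbed since `η ≤ 1/2`. -/
theorem isUnit_of_norm_sub_one_le {B : Matrix (Fin 3) (Fin 3) ℂ} {η : ℝ} (hη : η ≤ 1 / 2)
    (h : ‖B - 1‖ ≤ η) : IsUnit B ∧ ‖B‖ ≤ 2 ∧ ‖B⁻¹‖ ≤ 2 ∧ ‖B⁻¹ - 1‖ ≤ 2 * η := by
  have hu : IsUnit B := by
    have := isUnit_one_sub_of_norm_lt_one (x := 1 - B) (by rw [norm_sub_rev]; linarith)
    simpa using this
  have hinv : B⁻¹ * B = 1 := Matrix.nonsing_inv_mul _ ((Matrix.isUnit_iff_isUnit_det _).1 hu)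
  have e1 : B⁻¹ - 1 = B⁻¹ * (1 - B) := by rw [mul_sub, hinv, mul_one]
  have e2 : ‖B⁻¹ - 1‖ ≤ ‖B⁻¹‖ * η := by
    rw [e1]
    refine (norm_mul_le _ _).trans ?_
    rw [norm_sub_rev] at h
    gcongr
  have e3 : ‖B⁻¹‖ ≤ ‖B⁻¹ - 1‖ + 1 := by
    simpa using norm_add_le (B⁻¹ - 1) 1
  have e4 : ‖B⁻¹‖ ≤ 2 := by nlinarith [norm_nonneg B⁻¹]
  have e5 : ‖B‖ ≤ ‖B - 1‖ + 1 := by simpa using norm_add_le (B - 1) 1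
  have e6 : 0 ≤ η := (norm_nonneg _).trans h
  exact ⟨hu, by linarith, e4, e2.trans (by nlinarith)⟩

/-- The matrix whose columns are eigenvectors of `conjSymbol δ` if `a`, `b`, `c` are the
eigenvalues. -/
noncomputable def eigenMatrix (δ a b c : ℝ) : Matrix (Fin 3) (Fin 3) ℂ :=
  Matrix.of fun i j => (((!![1, (b - δ) / b, δ / c; a / (a - δ), 1, δ / (c - δ);
    a / δ, (b - δ) / δ, 1] : Matrix (Fin 3) (Fin 3) ℝ) i j : ℝ) : ℂ)

/-- A real diagonal matrix with complex entries. -/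
noncomputable def realDiag (a b c : ℝ) : Matrix (Fin 3) (Fin 3) ℂ :=
  Matrix.diagonal ![(a : ℂ), (b : ℂ), (c : ℂ)]

/-- In each column the first two rows of the eigenvector equation determine the two free entries;
the third row is then the characteristic equation. -/
theorem conjSymbol_mul_eigenMatrix {δ a b c : ℝ} (hδ : δ ≠ 0) (haδ : a - δ ≠ 0)
    (hb : b ≠ 0) (hc : c ≠ 0) (hcδ : c - δ ≠ 0) (ra : charCubic δ a = 0)
    (rb : charCubic δ b = 0) (rc : charCubic δ c = 0) :
    conjSymbol δ * eigenMatrix δ a b c = eigenMatrix δ a b c * realDiag a b c := by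
  unfold charCubic at ra rb rc
  have hM : conjSymbol δ = Matrix.of fun i j =>
      (((!![0, 0, δ; 0, δ, δ; -δ, -δ, 1] : Matrix (Fin 3) (Fin 3) ℝ) i j : ℝ) : ℂ) := by
    ext i j; fin_cases i <;> fin_cases j <;> simp [conjSymbol]
  have hD : realDiag a b c = Matrix.of fun i j =>
      (((!![a, 0, 0; 0, b, 0; 0, 0, c] : Matrix (Fin 3) (Fin 3) ℝ) i j : ℝ) : ℂ) := by
    ext i j; fin_cases i <;> fin_cases j <;> simp [realDiag]
  rw [hM, hD]
  ext i j
  simp only [eigenMatrix, Matrix.mul_apply, Matrix.of_apply, Fin.sum_univ_three]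
  norm_cast
  fin_cases i <;> fin_cases j <;> simp <;> field_simp <;> linarith

/-- The norm is the largest row sum; each row has two off-diagonal entries, each of size at most
`2δ`. -/
theorem norm_eigenMatrix_sub_one_le {δ a b c : ℝ} (h0 : 0 < δ) (h1 : δ ≤ 1 / 16)
    (ha : a ∈ Icc (δ ^ 2 - 3 * δ ^ 3) (δ ^ 2)) (hb : b ∈ Icc δ (δ + 2 * δ ^ 2))
    (hc : c ∈ Icc (1 - δ) 1) : ‖eigenMatrix δ a b c - 1‖ ≤ 4 * δ := by
  obtain ⟨ha1, ha2⟩ := ha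
  obtain ⟨hb1, hb2⟩ := hb
  obtain ⟨hc1, hc2⟩ := hc
  have ha0 : 0 ≤ a := by nlinarith [pow_pos h0 2, pow_pos h0 3]
  have haδ : 0 < δ - a := by nlinarith
  have hb0 : 0 < b := by linarith
  have hc0 : 0 < c := by linarith
  have hcδ : 0 < c - δ := by linarith
  have e1 : |a / (a - δ)| ≤ 2 * δ := by
    rw [abs_div, abs_of_nonneg ha0, abs_sub_comm, abs_of_pos haδ, div_le_iff₀ haδ]; nlinarith
  have e2 : |a / δ| ≤ 2 * δ := by
    rw [abs_of_nonneg (by positivity), div_le_iff₀ h0]; nlinarith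
  have e3 : |(b - δ) / b| ≤ 2 * δ := by
    rw [abs_of_nonneg (div_nonneg (by linarith) hb0.le), div_le_iff₀ hb0]; nlinarith
  have e4 : |(b - δ) / δ| ≤ 2 * δ := by
    rw [abs_of_nonneg (div_nonneg (by linarith) h0.le), div_le_iff₀ h0]; nlinarith
  have e5 : |δ / c| ≤ 2 * δ := by
    rw [abs_of_nonneg (by positivity), div_le_iff₀ hc0]; nlinarith
  have e6 : |δ / (c - δ)| ≤ 2 * δ := by
    rw [abs_of_nonneg (by positivity), div_le_iff₀ hcδ]; nlinarith
  have n (x : ℝ) : ‖(x : ℂ)‖ = |x| := by simp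
  refine linfty_opNorm_le_of_row_sum_le fun i => ?_
  simp only [eigenMatrix, Matrix.sub_apply, Matrix.of_apply, Matrix.one_apply]
  fin_cases i <;> 
    simp [-Complex.ofReal_div, -Complex.ofReal_sub, n, -norm_div, -Complex.norm_real] <;> linarith

/-- The mean value bound costs a factor `τ |l - d| ≤ k τ d`, unbounded in time. A quarter of the
available decay `exp(-3τd/4)` absorbs it, and `exp(-τd/2)` remains. -/
theorem abs_exp_neg_sub_exp_neg_le {k d l τ : ℝ} (hk0 : 0 ≤ k) (hd : 0 ≤ d) (hl : 3 / 4 * d ≤ l)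
    (hk : |l - d| ≤ k * d) (hτ : 0 ≤ τ) :
    |Real.exp (-(τ * l)) - Real.exp (-(τ * d))| ≤ 4 * k * Real.exp (-(τ * d / 2)) := by
  -- A one-sided bound from `1 + z ≤ exp z`; using it in both orders controls the absolute value.
  have key : ∀ x y : ℝ, 3 / 4 * d ≤ x → Real.exp (-(τ * x)) - Real.exp (-(τ * y)) ≤
      τ * |x - y| * Real.exp (-(3 / 4 * (τ * d))) := by
    intro x y hx
    have e1 : Real.exp (-(τ * y)) = Real.exp (-(τ * x)) * Real.exp (τ * (x - y)) := by
      rw [← Real.exp_add]; ring_nf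
    have e2 : 1 + τ * (x - y) ≤ Real.exp (τ * (x - y)) := by
      linarith [Real.add_one_le_exp (τ * (x - y))]
    have e3 : Real.exp (-(τ * x)) ≤ Real.exp (-(3 / 4 * (τ * d))) :=
      Real.exp_le_exp.2 (by nlinarith)
    have e4 : 1 - Real.exp (τ * (x - y)) ≤ τ * |x - y| := by
      nlinarith [neg_abs_le (x - y)]
    calc _ = Real.exp (-(τ * x)) * (1 - Real.exp (τ * (x - y))) := by rw [e1]; ring
      _ ≤ Real.exp (-(τ * x)) * (τ * |x - y|) := by gcongr
      _ ≤ Real.exp (-(3 / 4 * (τ * d))) * (τ * |x - y|) := by gcongr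
      _ = _ := by ring
  have h1 : |Real.exp (-(τ * l)) - Real.exp (-(τ * d))| ≤
      τ * |l - d| * Real.exp (-(3 / 4 * (τ * d))) := by
    refine abs_le.2 ⟨?_, key l d hl⟩
    have := key d l (by linarith)
    rw [abs_sub_comm] at this
    linarith
  have e5 : Real.exp (-(3 / 4 * (τ * d))) =
      Real.exp (-(τ * d / 4)) * Real.exp (-(τ * d / 2)) := by
    rw [← Real.exp_add]; ring_nf
  have e6 : τ * d / 4 * Real.exp (-(τ * d / 4)) ≤ 1 := by
    have := Real.add_one_le_exp (τ * d / 4)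
    rw [Real.exp_neg, ← div_eq_mul_inv, div_le_one (Real.exp_pos _)]
    linarith
  calc _ ≤ τ * (k * d) * (Real.exp (-(τ * d / 4)) * Real.exp (-(τ * d / 2))) := by
        rw [← e5]; exact h1.trans (by gcongr)
    _ = 4 * k * (τ * d / 4 * Real.exp (-(τ * d / 4))) * Real.exp (-(τ * d / 2)) := by ring
    _ ≤ 4 * k * 1 * Real.exp (-(τ * d / 2)) := by gcongr
    _ = _ := by ring

theorem norm_realDiag_le {a b c C : ℝ} (ha : |a| ≤ C) (hb : |b| ≤ C) (hc : |c| ≤ C) :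
    ‖realDiag a b c‖ ≤ C := by
  rw [realDiag, Matrix.linfty_opNorm_diagonal, pi_norm_le_iff_of_nonneg ((abs_nonneg _).trans ha)]
  intro i
  fin_cases i <;> simpa

theorem exp_smul_realDiag (τ a b c : ℝ) :
    NormedSpace.exp (-τ • realDiag a b c) =
      realDiag (Real.exp (-(τ * a))) (Real.exp (-(τ * b))) (Real.exp (-(τ * c))) := by
  have : -τ • realDiag a b c =
      Matrix.diagonal ![((-(τ * a) : ℝ) : ℂ), ((-(τ * b) : ℝ) : ℂ), ((-(τ * c) : ℝ) : ℂ)] := by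
    ext i j; fin_cases i <;> fin_cases j <;> simp [realDiag]
  rw [this, Matrix.exp_diagonal, realDiag]
  congr 1
  ext i
  rw [Pi.coe_exp, ← Complex.exp_eq_exp_ℂ]
  fin_cases i <;> simp

theorem realDiag_sub (a b c a' b' c' : ℝ) :
    realDiag a b c - realDiag a' b' c' = realDiag (a - a') (b - b') (c - c') := by
  ext i j; fin_cases i <;> fin_cases j <;> simp [realDiag]

/-- The product of the second and the third diagonalizer, for `δ = r ^ (2 - 2σ)`. -/
noncomputable def refinedDiagonalizer (δ : ℝ) : Matrix (Fin 3) (Fin 3) ℂ :=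
  (1 + (δ : ℂ) • !![0, 0, 1; 0, 0, 1; 1, 1, 0]) *
    (1 + ((δ ^ 2 : ℝ) : ℂ) • !![0, 0, 0; 0, 0, 1; 0, 1, 0])

theorem norm_second_diagonalizer_sub_one_le {δ : ℝ} (h0 : 0 ≤ δ) :
    ‖(1 + (δ : ℂ) • !![0, 0, 1; 0, 0, 1; 1, 1, 0] : Matrix (Fin 3) (Fin 3) ℂ) - 1‖ ≤ 2 * δ := by
  refine linfty_opNorm_le_of_row_sum_le fun i => ?_
  rw [add_sub_cancel_left]
  fin_cases i <;> simp [abs_of_nonneg h0] <;> linarith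

theorem norm_third_diagonalizer_sub_one_le (δ : ℝ) :
    ‖(1 + ((δ ^ 2 : ℝ) : ℂ) • !![0, 0, 0; 0, 0, 1; 0, 1, 0] : Matrix (Fin 3) (Fin 3) ℂ) - 1‖ ≤
      δ ^ 2 := by
  refine linfty_opNorm_le_of_row_sum_le fun i => ?_
  rw [add_sub_cancel_left]
  fin_cases i <;> simp [sq_nonneg]

theorem norm_refinedDiagonalizer_sub_one_le {δ : ℝ} (h0 : 0 ≤ δ) (h1 : δ ≤ 1 / 16) :
    ‖refinedDiagonalizer δ - 1‖ ≤ 4 * δ := by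
  have e1 := norm_second_diagonalizer_sub_one_le h0
  have e2 := norm_third_diagonalizer_sub_one_le δ
  rw [refinedDiagonalizer]
  set P := (1 + (δ : ℂ) • !![0, 0, 1; 0, 0, 1; 1, 1, 0] : Matrix (Fin 3) (Fin 3) ℂ)
  set Q := (1 + ((δ ^ 2 : ℝ) : ℂ) • !![0, 0, 0; 0, 0, 1; 0, 1, 0] : Matrix (Fin 3) (Fin 3) ℂ)
  have e3 : P * Q - 1 = (P - 1) * (Q - 1) + (P - 1) + (Q - 1) := by noncomm_ring
  rw [e3]
  refine (norm_add₃_le ..).trans ?_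
  have e4 : ‖(P - 1) * (Q - 1)‖ ≤ 2 * δ * δ ^ 2 := (norm_mul_le _ _).trans (by gcongr)
  nlinarith [pow_nonneg h0 2, pow_nonneg h0 3]

theorem norm_conj_sub_conj_le {S T E D : Matrix (Fin 3) (Fin 3) ℂ} {η e : ℝ} (hη : η ≤ 1 / 2)
    (hS : ‖S - 1‖ ≤ η) (hT : ‖T - 1‖ ≤ η) (hE : ‖E‖ ≤ e) (hD : ‖D‖ ≤ e)
    (hED : ‖E - D‖ ≤ 3 * (4 * η) * e) :
    ‖S * E * S⁻¹ - T * D * T⁻¹‖ ≤ 60 * η * e := by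
  obtain ⟨-, -, hS2, hS3⟩ := isUnit_of_norm_sub_one_le hη hS
  obtain ⟨-, hT1, hT2, hT3⟩ := isUnit_of_norm_sub_one_le hη hT
  have hη0 : 0 ≤ η := (norm_nonneg _).trans hS
  have he0 : 0 ≤ e := (norm_nonneg _).trans hE
  have e1 : ‖S - T‖ ≤ 2 * η := by
    have : S - T = (S - 1) - (T - 1) := by abel
    rw [this]; exact (norm_sub_le _ _).trans (by linarith)
  have e2 : ‖S⁻¹ - T⁻¹‖ ≤ 4 * η := by
    have : S⁻¹ - T⁻¹ = (S⁻¹ - 1) - (T⁻¹ - 1) := by abel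
    rw [this]; exact (norm_sub_le _ _).trans (by linarith)
  -- One factor is replaced at a time; the three terms contribute `4`, `48` and `8` times `η e`.
  have e3 : S * E * S⁻¹ - T * D * T⁻¹ =
      (S - T) * E * S⁻¹ + T * (E - D) * S⁻¹ + T * D * (S⁻¹ - T⁻¹) := by noncomm_ring
  have m (X Y Z : Matrix (Fin 3) (Fin 3) ℂ) : ‖X * Y * Z‖ ≤ ‖X‖ * ‖Y‖ * ‖Z‖ :=
    (norm_mul_le _ _).trans (by gcongr; exact norm_mul_le _ _)
  rw [e3]
  refine (norm_add₃_le ..).trans ?_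
  have f1 : ‖(S - T) * E * S⁻¹‖ ≤ 2 * η * e * 2 := (m ..).trans (by gcongr)
  have f2 : ‖T * (E - D) * S⁻¹‖ ≤ 2 * (3 * (4 * η) * e) * 2 := (m ..).trans (by gcongr)
  have f3 : ‖T * D * (S⁻¹ - T⁻¹)‖ ≤ 2 * e * (4 * η) := (m ..).trans (by gcongr)
  linarith

/-- The slowest mode `δ²` dictates the exponential. All three eigenvalues have relative error at
most `3δ`, and both conjugating matrices are within `4δ` of the identity, so `60 · 4δ = 240δ`. -/
theorem norm_exp_conjSymbol_sub_le {δ τ : ℝ} (h0 : 0 < δ) (h1 : δ ≤ 1 / 16) (hτ : 0 ≤ τ) :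
    ‖NormedSpace.exp (-τ • conjSymbol δ) - refinedDiagonalizer δ *
        NormedSpace.exp (-τ • realDiag (δ ^ 2) δ 1) * (refinedDiagonalizer δ)⁻¹‖ ≤
      240 * δ * Real.exp (-(τ * δ ^ 2 / 2)) := by
  obtain ⟨a, ha, ra⟩ := exists_charCubic_root_near_sq h0 h1
  obtain ⟨b, hb, rb⟩ := exists_charCubic_root_near_self h0 h1
  obtain ⟨c, hc, rc⟩ := exists_charCubic_root_near_one h0 h1
  have hS := norm_eigenMatrix_sub_one_le h0 h1 ha hb hc
  have hT := norm_refinedDiagonalizer_sub_one_le h0.le h1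
  have hu := (isUnit_of_norm_sub_one_le (by linarith) hS).1
  obtain ⟨ha1, ha2⟩ := ha
  obtain ⟨hb1, hb2⟩ := hb
  obtain ⟨hc1, hc2⟩ := hc
  have haδ : a < δ := by nlinarith
  have hMS := conjSymbol_mul_eigenMatrix h0.ne' (by linarith) (by linarith) (by linarith)
    (by linarith) ra rb rc
  set S := eigenMatrix δ a b c
  have hM : -τ • conjSymbol δ = S * (-τ • realDiag a b c) * S⁻¹ := by
    rw [Matrix.mul_smul, ← hMS, Matrix.smul_mul, mul_assoc,
      Matrix.mul_nonsing_inv _ ((Matrix.isUnit_iff_isUnit_det _).1 hu), mul_one]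
  rw [hM, Matrix.exp_conj _ _ hu, exp_smul_realDiag, exp_smul_realDiag]
  have hδ2 : δ ^ 2 ≤ δ := by nlinarith
  -- This gives `a ≥ δ² - 3δ³ ≥ (13/16) δ²`, which is above the threshold `3/4` required to compare
  -- exponentials.
  have hδ3 : δ ^ 3 ≤ δ ^ 2 / 16 := by nlinarith [pow_pos h0 2]
  have hpos := pow_pos h0 2
  have mono : ∀ d, δ ^ 2 / 2 ≤ d → |Real.exp (-(τ * d))| ≤ Real.exp (-(τ * δ ^ 2 / 2)) := by
    intro d hd
    rw [Real.abs_exp]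
    exact Real.exp_le_exp.2 (by nlinarith)
  have diff : ∀ d l, δ ^ 2 ≤ d → 3 / 4 * d ≤ l → |l - d| ≤ 3 * δ * d →
      |Real.exp (-(τ * l)) - Real.exp (-(τ * d))| ≤
        3 * (4 * δ) * Real.exp (-(τ * δ ^ 2 / 2)) := by
    intro d l hd hl hk
    refine (abs_exp_neg_sub_exp_neg_le (by positivity) (by linarith) hl hk hτ).trans ?_
    have : Real.exp (-(τ * d / 2)) ≤ Real.exp (-(τ * δ ^ 2 / 2)) :=
      Real.exp_le_exp.2 (by nlinarith)
    calc _ ≤ 4 * (3 * δ) * Real.exp (-(τ * δ ^ 2 / 2)) := by gcongr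
      _ = _ := by ring
  refine (norm_conj_sub_conj_le (η := 4 * δ) (e := Real.exp (-(τ * δ ^ 2 / 2))) (by linarith)
    hS hT (norm_realDiag_le (mono _ ?_) (mono _ ?_) (mono _ ?_))
    (norm_realDiag_le (mono _ ?_) (mono _ ?_) (mono _ ?_)) ?_).trans (le_of_eq (by ring))
  any_goals nlinarith
  rw [realDiag_sub]
  refine (norm_realDiag_le (diff _ _ ?_ ?_ ?_) (diff _ _ ?_ ?_ ?_) (diff _ _ ?_ ?_ ?_)).trans ?_
  any_goals nlinarith
  any_goals (rw [abs_le]; constructor <;> nlinarith)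
  nlinarith [mul_pos h0 (Real.exp_pos (-(τ * δ ^ 2 / 2)))]

end TripleDiffusion

namespace TripleDiffusion
open scoped Matrix.Norms.Operator

/-! ### The solution operators in the frequency space -/

theorem sq_rpow_two_sub {σ r : ℝ} (hr : 0 ≤ r) : r ^ (4 - 4 * σ) = (r ^ (2 - 2 * σ)) ^ 2 := by
  rw [← Real.rpow_natCast, ← Real.rpow_mul hr]; congr 1; push_cast; ring

theorem T₁_mul_T₁half {σ r : ℝ} (hr : 0 ≤ r) :
    T₁ σ r * T₁half σ r = refinedDiagonalizer (r ^ (2 - 2 * σ)) := by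
  rw [T₁, T₁half, refinedDiagonalizer, sq_rpow_two_sub hr]

theorem isUnit_T₁ {σ r : ℝ} (hr : 0 ≤ r) (h : r ^ (2 - 2 * σ) ≤ 1 / 16) : IsUnit (T₁ σ r) :=
  (isUnit_of_norm_sub_one_le (by linarith)
    (norm_second_diagonalizer_sub_one_le (Real.rpow_nonneg hr _))).1

theorem isUnit_T₁half {σ r : ℝ} (hr : 0 ≤ r) (h : r ^ (2 - 2 * σ) ≤ 1 / 16) :
    IsUnit (T₁half σ r) := by
  have h0 := Real.rpow_nonneg hr (2 - 2 * σ)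
  have := (isUnit_of_norm_sub_one_le (by nlinarith)
    (norm_third_diagonalizer_sub_one_le (r ^ (2 - 2 * σ)))).1
  rwa [← sq_rpow_two_sub hr] at this

theorem rpow_mul_rpow_two_sub {σ r : ℝ} (hr : 0 < r) :
    r ^ (2 * σ) * r ^ (2 - 2 * σ) = r ^ (2 : ℕ) := by
  rw [← Real.rpow_add hr, ← Real.rpow_natCast]; congr 1; push_cast; ring

theorem rpow_mul_sq_rpow_two_sub {σ r : ℝ} (hr : 0 < r) :
    r ^ (2 * σ) * (r ^ (2 - 2 * σ)) ^ 2 = r ^ (4 - 2 * σ) := by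
  rw [← Real.rpow_natCast, ← Real.rpow_mul hr.le, ← Real.rpow_add hr]; congr 1; push_cast; ring

theorem A_eq_smul {σ r : ℝ} (hr : 0 < r) :
    A σ r = r ^ (2 * σ) • (T₀ * conjSymbol (r ^ (2 - 2 * σ)) * T₀⁻¹) := by
  rw [← symbol_mul_T₀, mul_assoc,
    Matrix.mul_nonsing_inv _ ((Matrix.isUnit_iff_isUnit_det _).1 isUnit_T₀), mul_one, A,
    ← rpow_mul_rpow_two_sub hr]
  ext i j
  simp
  ring

theorem refSymbol_eq_smul {σ r : ℝ} (hr : 0 < r) :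
    refSymbol σ r = r ^ (2 * σ) • realDiag ((r ^ (2 - 2 * σ)) ^ 2) (r ^ (2 - 2 * σ)) 1 := by
  rw [refSymbol, ← rpow_mul_sq_rpow_two_sub hr, ← rpow_mul_rpow_two_sub (σ := σ) hr]
  ext i j
  fin_cases i <;> fin_cases j <;> simp [realDiag]

/-- The difference of the two solution operators. -/
noncomputable def propagatorDiff (σ t r : ℝ) : Matrix (Fin 3) (Fin 3) ℂ :=
  NormedSpace.exp (-t • A σ r) - T₀ * T₁ σ r * T₁half σ r * NormedSpace.exp (-t • refSymbol σ r) *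
    ((T₁half σ r)⁻¹ * (T₁ σ r)⁻¹ * T₀⁻¹)

theorem norm_propagatorDiff_le {σ t r : ℝ} (hr : 0 < r) (h : r ^ (2 - 2 * σ) ≤ 1 / 16)
    (ht : 0 ≤ t) :
    ‖propagatorDiff σ t r‖ ≤ ‖T₀‖ * ‖T₀⁻¹‖ * 240 *
      (r ^ (2 - 2 * σ) * Real.exp (-(t * r ^ (4 - 2 * σ) / 2))) := by
  have hδ : 0 < r ^ (2 - 2 * σ) := Real.rpow_pos_of_pos hr _
  have e1 : -t • A σ r =
      T₀ * (-(t * r ^ (2 * σ)) • conjSymbol (r ^ (2 - 2 * σ))) * T₀⁻¹ := by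
    rw [A_eq_smul hr, smul_smul, Matrix.mul_smul, Matrix.smul_mul, neg_mul]
  have e2 : -t • refSymbol σ r =
      -(t * r ^ (2 * σ)) • realDiag ((r ^ (2 - 2 * σ)) ^ 2) (r ^ (2 - 2 * σ)) 1 := by
    rw [refSymbol_eq_smul hr, smul_smul, neg_mul]
  have key := norm_exp_conjSymbol_sub_le hδ h (τ := t * r ^ (2 * σ)) (by positivity)
  rw [propagatorDiff, e1, Matrix.exp_conj _ _ isUnit_T₀, e2, ← Matrix.mul_inv_rev,
    mul_assoc T₀ (T₁ σ r), T₁_mul_T₁half hr.le]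
  set E := NormedSpace.exp (-(t * r ^ (2 * σ)) • conjSymbol (r ^ (2 - 2 * σ)))
  set D := NormedSpace.exp (-(t * r ^ (2 * σ)) • realDiag ((r ^ (2 - 2 * σ)) ^ 2)
    (r ^ (2 - 2 * σ)) 1)
  set R := refinedDiagonalizer (r ^ (2 - 2 * σ))
  have e3 : T₀ * E * T₀⁻¹ - T₀ * R * D * (R⁻¹ * T₀⁻¹) = T₀ * (E - R * D * R⁻¹) * T₀⁻¹ := by
    noncomm_ring
  have e4 : t * r ^ (2 * σ) * (r ^ (2 - 2 * σ)) ^ 2 / 2 = t * r ^ (4 - 2 * σ) / 2 := by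
    rw [mul_assoc, rpow_mul_sq_rpow_two_sub hr]
  rw [e4] at key
  rw [e3]
  calc _ ≤ ‖T₀‖ * ‖E - R * D * R⁻¹‖ * ‖T₀⁻¹‖ :=
        (norm_mul_le _ _).trans (by gcongr; exact norm_mul_le _ _)
    _ ≤ ‖T₀‖ * (240 * r ^ (2 - 2 * σ) * Real.exp (-(t * r ^ (4 - 2 * σ) / 2))) * ‖T₀⁻¹‖ := by
        gcongr
    _ = _ := by ring

/-- Inversion is discontinuous at singular matrices, but Cramer's formula reduces it to the scalar
inverse, which is measurable. -/
theorem stronglyMeasurable_matrix_inv {α : Type*} [MeasurableSpace α]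
    {X : α → Matrix (Fin 3) (Fin 3) ℂ} (h : StronglyMeasurable X) :
    StronglyMeasurable fun a => (X a)⁻¹ := by
  simp only [Matrix.inv_def, Ring.inverse_eq_inv']
  exact ((Continuous.matrix_det continuous_id).comp_stronglyMeasurable
    h).measurable.inv.stronglyMeasurable.smul
      ((Continuous.matrix_adjugate continuous_id).comp_stronglyMeasurable h)

theorem stronglyMeasurable_propagatorDiff (σ t : ℝ) : StronglyMeasurable (propagatorDiff σ t) := by
  have hp (p : ℝ) : StronglyMeasurable fun r : ℝ => ((r ^ p : ℝ) : ℂ) :=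
    (Complex.measurable_ofReal.comp (measurable_id.pow_const p)).stronglyMeasurable
  have hsq : StronglyMeasurable fun r : ℝ => ((r ^ (2 : ℕ) : ℝ) : ℂ) :=
    (Complex.measurable_ofReal.comp (measurable_id.pow_const 2)).stronglyMeasurable
  have hA : StronglyMeasurable fun r => A σ r :=
    (hsq.smul_const _).add ((hp _).smul_const _)
  have h1 : StronglyMeasurable fun r => T₁ σ r :=
    stronglyMeasurable_const.add ((hp _).smul_const _)
  have h2 : StronglyMeasurable fun r => T₁half σ r :=
    stronglyMeasurable_const.add ((hp _).smul_const _)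
  have hR : StronglyMeasurable fun r => refSymbol σ r := by
    refine (Continuous.matrix_diagonal continuous_id).comp_stronglyMeasurable
      (measurable_pi_iff.2 fun i => ?_).stronglyMeasurable
    fin_cases i
    · exact (hp _).measurable
    · exact hsq.measurable
    · exact (hp _).measurable
  have he {X : ℝ → Matrix (Fin 3) (Fin 3) ℂ} (h : StronglyMeasurable X) :
      StronglyMeasurable fun r => NormedSpace.exp (-t • X r) :=
    NormedSpace.exp_continuous.comp_stronglyMeasurable (h.const_smul (-t))
  exact (he hA).sub ((((stronglyMeasurable_const.mul h1).mul h2).mul (he hR)).mul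
    (((stronglyMeasurable_matrix_inv h2).mul (stronglyMeasurable_matrix_inv h1)).mul
      stronglyMeasurable_const))

/-! ### Uniqueness for linear systems with constant coefficients -/

/-- The product of a matrix and a vector as a continuous bilinear map. -/
noncomputable def mulVecCLM :
    Matrix (Fin 3) (Fin 3) ℂ →L[ℝ] (Fin 3 → ℂ) →L[ℝ] Fin 3 → ℂ :=
  LinearMap.mkContinuous₂ (LinearMap.mk₂ ℝ (fun M v => M *ᵥ v) Matrix.add_mulVec
    (fun c M v => Matrix.smul_mulVec c M v) Matrix.mulVec_add
    (fun c M v => Matrix.mulVec_smul M c v)) 1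
    (fun M v => by simpa using Matrix.linfty_opNorm_mulVec M v)

theorem mulVecCLM_apply (M : Matrix (Fin 3) (Fin 3) ℂ) (v : Fin 3 → ℂ) :
    mulVecCLM M v = M *ᵥ v := rfl

/-- No derivative is given at `0`: the function is constant on `[s, t]` for each `s > 0`, and
continuity at `0` lets `s` tend to `0`. -/
theorem eq_zero_value_of_hasDerivAt_zero {E : Type*} [NormedAddCommGroup E] [NormedSpace ℝ E]
    {f : ℝ → E} (hfc : ContinuousOn f (Ici 0)) (hfd : ∀ s, 0 < s → HasDerivAt f 0 s) {t : ℝ}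
    (ht : 0 ≤ t) : f t = f 0 := by
  have hft : ∀ s ∈ Ioc 0 t, f s = f t := by
    intro s hs
    refine (constant_of_has_deriv_right_zero (hfc.mono fun x hx => hs.1.le.trans hx.1)
      (fun x hx => (hfd x (hs.1.trans_le hx.1)).hasDerivWithinAt) t ⟨hs.2, le_rfl⟩).symm
  rcases ht.eq_or_lt with rfl | ht'
  · rfl
  have l1 : Filter.Tendsto f (nhdsWithin 0 (Ioi 0)) (nhds (f 0)) :=
    (hfc 0 self_mem_Ici).mono_left (nhdsWithin_mono _ Ioi_subset_Ici_self)
  refine tendsto_nhds_unique (tendsto_const_nhds.congr' ?_) l1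
  filter_upwards [Ioc_mem_nhdsGT ht'] with s hs using (hft s hs).symm

theorem hasDerivAt_exp_mulVec {B : Matrix (Fin 3) (Fin 3) ℂ} {w : ℝ → Fin 3 → ℂ} {s : ℝ}
    (hd : HasDerivAt w (-(B *ᵥ w s)) s) :
    HasDerivAt (fun s : ℝ => mulVecCLM (NormedSpace.exp (s • B)) (w s)) 0 s := by
  have hexp : HasDerivAt (fun s : ℝ => NormedSpace.exp (s • B)) (NormedSpace.exp (s • B) * B) s :=
    hasDerivAt_exp_smul_const B s
  have h := mulVecCLM.hasDerivAt_of_bilinear (fun _ => hexp) (fun _ => hd)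
  have h0 : mulVecCLM (NormedSpace.exp (s • B)) (-(B *ᵥ w s)) +
      mulVecCLM (NormedSpace.exp (s • B) * B) (w s) = 0 := by
    rw [mulVecCLM_apply, mulVecCLM_apply, Matrix.mulVec_neg, Matrix.mulVec_mulVec,
      neg_add_cancel]
  exact h.congr_deriv h0

theorem continuousOn_exp_mulVec (B : Matrix (Fin 3) (Fin 3) ℂ) {w : ℝ → Fin 3 → ℂ}
    (hc : ContinuousOn w (Ici 0)) :
    ContinuousOn (fun s : ℝ => mulVecCLM (NormedSpace.exp (s • B)) (w s)) (Ici 0) :=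
  ContinuousOn.clm_apply (mulVecCLM.continuous.comp_continuousOn fun s _ =>
    (hasDerivAt_exp_smul_const B s).continuousAt.continuousWithinAt) hc

/-- Uniqueness for the linear system `w' = -B w`. -/
theorem eq_exp_mulVec_of_hasDerivAt {B : Matrix (Fin 3) (Fin 3) ℂ} {w : ℝ → Fin 3 → ℂ}
    (hc : ContinuousOn w (Ici 0)) (hd : ∀ t, 0 < t → HasDerivAt w (-(B *ᵥ w t)) t) {t : ℝ}
    (ht : 0 ≤ t) : w t = NormedSpace.exp (-t • B) *ᵥ w 0 := by
  -- Integrating factor: `exp(tB) w(t)` is constant.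
  have h1 := eq_zero_value_of_hasDerivAt_zero (continuousOn_exp_mulVec B hc)
    (fun s hs => hasDerivAt_exp_mulVec (hd s hs)) ht
  simp only [mulVecCLM_apply, zero_smul, NormedSpace.exp_zero, Matrix.one_mulVec] at h1
  have h2 : NormedSpace.exp (-t • B) * NormedSpace.exp (t • B) = 1 := by
    have hu := (Matrix.isUnit_iff_isUnit_det _).1 (Matrix.isUnit_exp (t • B))
    rw [neg_smul, Matrix.exp_neg, Matrix.nonsing_inv_mul _ hu]
  rw [← h1, Matrix.mulVec_mulVec, h2, Matrix.one_mulVec]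

end TripleDiffusion

namespace TripleDiffusion

/-! ### The Fourier transform on `L¹ + L²` -/

theorem eLpNorm_two_comp_dilation {n : ℕ} {F : Type*} [NormedAddCommGroup F] (f : Rn n → F)
    {c : ℝ} (hc : 0 < c) :
    eLpNorm (fun ξ => f (c • ξ)) 2 volume =
      ENNReal.ofReal (c ^ (-(n / 2 : ℝ))) * eLpNorm f 2 volume := by
  have he : MeasurableEmbedding fun ξ : Rn n => c • ξ :=
    (Homeomorph.smulOfNeZero c hc.ne').measurableEmbedding
  have h := he.eLpNorm_map_measure (g := f) (p := 2) (μ := volume)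
  rw [Measure.map_addHaar_smul volume hc.ne', eLpNorm_smul_measure_of_ne_top (by simp)] at h
  change _ = eLpNorm (f ∘ fun ξ : Rn n => c • ξ) 2 volume at h
  change eLpNorm (f ∘ fun ξ : Rn n => c • ξ) 2 volume = _
  rw [← h, smul_eq_mul, ENNReal.ofReal_rpow_of_nonneg (abs_nonneg _) (by simp)]
  congr 2
  rw [abs_of_pos (by positivity), finrank_euclideanSpace_fin, ← Real.rpow_natCast,
    ← Real.rpow_neg hc.le, ← Real.rpow_mul hc.le]
  congr 1
  simp
  ring

theorem aestronglyMeasurable_comp_dilation {n : ℕ} {F : Type*} [NormedAddCommGroup F]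
    {f : Rn n → F} (hf : AEStronglyMeasurable f volume) {c : ℝ} (hc : c ≠ 0) :
    AEStronglyMeasurable (fun ξ => f (c • ξ)) volume := by
  refine AEStronglyMeasurable.comp_measurable (f := fun ξ : Rn n => c • ξ) ?_ (by fun_prop)
  rw [Measure.map_addHaar_smul volume hc]
  exact hf.smul_measure _

theorem ae_comp_dilation {n : ℕ} {p : Rn n → Prop} (h : ∀ᵐ ξ, p ξ) {c : ℝ} (hc : c ≠ 0) :
    ∀ᵐ ξ : Rn n, p (c • ξ) := by
  refine ae_of_ae_map (f := fun ξ : Rn n => c • ξ) (by fun_prop) ?_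
  rw [Measure.map_addHaar_smul volume hc]
  exact Measure.ae_smul_measure h _

theorem continuous_fourier_of_integrable {n : ℕ} {f : Rn n → ℂ} (hf : Integrable f) :
    Continuous (𝓕 f) :=
  VectorFourier.fourierIntegral_continuous Real.continuous_fourierChar
    (innerSL ℝ).continuous₂ hf

theorem enorm_fourier_le {n : ℕ} (f : Rn n → ℂ) (ξ : Rn n) :
    ‖𝓕 f ξ‖ₑ ≤ eLpNorm f 1 volume := by
  rw [Real.fourier_eq, eLpNorm_one_eq_lintegral_enorm]
  refine (enorm_integral_le_lintegral_enorm _).trans (le_of_eq ?_)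
  congr 1 with x
  rw [← ofReal_norm, ← ofReal_norm, Circle.norm_smul]

/-- Both transforms satisfy the multiplication formula `∫ φ f̂ = ∫ φ̂ f` for test functions `φ`, on
the `L²` side through tempered distributions and on the `L¹` side through the integral formula. -/
theorem fourier_toLp_ae_eq {n : ℕ} {f : Rn n → ℂ} (h1 : MemLp f 1 volume)
    (h2 : MemLp f 2 volume) :
    (𝓕 (h2.toLp f) : Lp (α := Rn n) ℂ 2 volume) =ᵐ[volume] 𝓕 f := by
  have hi := memLp_one_iff_integrable.1 h1
  refine ae_eq_of_integral_contDiff_smul_eq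
    ((Lp.memLp _).locallyIntegrable (by norm_num))
    (continuous_fourier_of_integrable hi).locallyIntegrable fun g hg hg' => ?_
  have hgc : HasCompactSupport fun x => (g x : ℂ) := hg'.comp_left (g := fun r : ℝ => (r : ℂ)) rfl
  let φ : 𝓢(Rn n, ℂ) := hgc.toSchwartzMap (Complex.ofRealCLM.contDiff.comp hg)
  have hφ : ∀ x, φ x = (g x : ℂ) := fun x => rfl
  have e1 : ∫ x, φ x • (𝓕 (h2.toLp f) : Lp (α := Rn n) ℂ 2 volume) x =
      ∫ x, (𝓕 φ) x • (h2.toLp f) x := by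
    rw [← Lp.toTemperedDistribution_apply, ← Lp.fourier_toTemperedDistribution_eq,
      TemperedDistribution.fourier_apply, Lp.toTemperedDistribution_apply]
  have e2 : ∫ x, (𝓕 φ) x • (h2.toLp f) x = ∫ x, (𝓕 (φ : Rn n → ℂ)) x • f x := by
    refine integral_congr_ae ?_
    filter_upwards [h2.coeFn_toLp] with x hx
    rw [hx]; rfl
  have e3 : ∫ x, (𝓕 (φ : Rn n → ℂ)) x • f x = ∫ x, φ x • 𝓕 f x := by
    have := VectorFourier.integral_fourierIntegral_smul_eq_flip (μ := volume) (ν := volume)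
      (L := innerₗ (Rn n)) Real.continuous_fourierChar continuous_inner φ.integrable hi
    rw [flip_innerₗ] at this
    exact this
  have e := e1.trans (e2.trans e3)
  simpa [hφ] using e

/-- Any splitting of a function into parts in `L¹` and `L²` computes its transform. -/
theorem fourier_ae_eq_of_add {n : ℕ} {f a b : Rn n → ℂ} {m : ℝ} (hm : 1 ≤ m) (hm' : m ≤ 2)
    (hf : MemLp f (ENNReal.ofReal m) volume) (hab : a + b = f) (ha : MemLp a 1 volume)
    (hb : MemLp b 2 volume) :
    ∀ᵐ ξ, fourier f ξ = 𝓕 a ((2 * Real.pi)⁻¹ • ξ) +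
      (𝓕 (hb.toLp b) : Lp (α := Rn n) ℂ 2 volume) ((2 * Real.pi)⁻¹ • ξ) := by
  have hc : (2 * Real.pi)⁻¹ ≠ 0 := by positivity
  have hl := largePart_memLp hm hf
  have hs := smallPart_memLp hm hm' hf
  -- The discrepancy of the two splittings lies in `L¹ ∩ L²`, where the two transforms agree.
  have hd : largePart f - a = b - smallPart f := by
    rw [sub_eq_sub_iff_add_eq_add, largePart_add_smallPart, ← hab, add_comm]
  have hd1 : MemLp (b - smallPart f) 1 volume := hd ▸ hl.sub ha
  have hd2 : MemLp (b - smallPart f) 2 volume := hb.sub hs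
  have k1 : largePart f = a + (b - smallPart f) := by rw [← hd]; abel
  have k2 : hb.toLp b = hs.toLp _ + hd2.toLp _ := by
    rw [← MemLp.toLp_add]; congr 1; abel
  have k3 : ∀ x, 𝓕 (largePart f) x = 𝓕 a x + 𝓕 (b - smallPart f) x := by
    intro x
    rw [k1]
    have := VectorFourier.fourierIntegral_add (μ := volume) (L := innerₗ (Rn n))
      Real.continuous_fourierChar continuous_inner (memLp_one_iff_integrable.1 ha)
      (memLp_one_iff_integrable.1 hd1)
    exact congrFun this x
  have k4 : (𝓕 (hb.toLp b) : Lp (α := Rn n) ℂ 2 volume) =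
      𝓕 (hs.toLp (smallPart f)) + 𝓕 (hd2.toLp (b - smallPart f)) := by
    rw [k2, FourierTransform.fourier_add]
  filter_upwards [ae_comp_dilation (fourier_toLp_ae_eq hd1 hd2) hc,
    ae_comp_dilation (Lp.coeFn_add (𝓕 (hs.toLp (smallPart f)) : Lp (α := Rn n) ℂ 2 volume)
      (𝓕 (hd2.toLp (b - smallPart f)))) hc] with ξ h1 h2
  rw [fourier, dif_pos hs, k3, k4, h2, Pi.add_apply, h1]
  ring

theorem aestronglyMeasurable_fourier {n : ℕ} {f : Rn n → ℂ} {m : ℝ} (hm : 1 ≤ m) (hm' : m ≤ 2)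
    (hf : MemLp f (ENNReal.ofReal m) volume) : AEStronglyMeasurable (fourier f) volume := by
  have hc : (2 * Real.pi)⁻¹ ≠ 0 := by positivity
  have hl := memLp_one_iff_integrable.1 (largePart_memLp hm hf)
  have hs := smallPart_memLp hm hm' hf
  refine (aestronglyMeasurable_comp_dilation
    (continuous_fourier_of_integrable hl).aestronglyMeasurable hc).add ?_
  simp only [dif_pos hs]
  exact aestronglyMeasurable_comp_dilation (Lp.aestronglyMeasurable _) hc

/-! ### Weighted bounds for the Fourier transform -/

/-- The weight `(1 + |ξ|)^{-(n+1)}`. -/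
noncomputable def weight (n : ℕ) (ξ : Rn n) : ℝ := (1 + ‖ξ‖) ^ (-(n + 1 : ℝ))

theorem weight_nonneg {n : ℕ} (ξ : Rn n) : 0 ≤ weight n ξ := by unfold weight; positivity

theorem weight_le_one {n : ℕ} (ξ : Rn n) : weight n ξ ≤ 1 :=
  Real.rpow_le_one_of_one_le_of_nonpos (by linarith [norm_nonneg ξ])
    (by have := n.cast_nonneg (α := ℝ); linarith)

theorem measurable_weight (n : ℕ) : Measurable (weight n) := by unfold weight; fun_prop

theorem memLp_weight (n : ℕ) : MemLp (weight n) 2 volume := by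
  refine (memLp_two_iff_integrable_sq (measurable_weight n).aestronglyMeasurable).2 ?_
  have := integrable_one_add_norm (E := Rn n) (μ := volume) (r := 2 * (n + 1))
    (by rw [finrank_euclideanSpace_fin]; have := n.cast_nonneg (α := ℝ); linarith)
  refine this.congr (.of_forall fun ξ => ?_)
  simp only [weight]
  rw [← Real.rpow_natCast, ← Real.rpow_mul (by positivity)]
  congr 1
  push_cast; ring

/-- For `a` the transform is bounded and the dilated weight has `L²` norm of order `L^(-n/2)`; for
`b` the weight is at most one and Plancherel applies. -/
theorem eLpNorm_weight_mul_le {n : ℕ} {f a b : Rn n → ℂ} {m L : ℝ} (hm : 1 ≤ m) (hm' : m ≤ 2)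
    (hf : MemLp f (ENNReal.ofReal m) volume) (hab : a + b = f) (ha : MemLp a 1 volume)
    (hb : MemLp b 2 volume) (hL : 0 < L) :
    eLpNorm (fun ξ => weight n (L • ξ) • fourier f ξ) 2 volume ≤
      ENNReal.ofReal (L ^ (-(n / 2 : ℝ))) * eLpNorm (weight n) 2 volume * eLpNorm a 1 volume +
        ENNReal.ofReal ((2 * Real.pi)⁻¹ ^ (-(n / 2 : ℝ))) * eLpNorm b 2 volume := by
  have hc : 0 < (2 * Real.pi)⁻¹ := by positivity
  have hw : AEStronglyMeasurable (fun ξ : Rn n => weight n (L • ξ)) volume :=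
    aestronglyMeasurable_comp_dilation (measurable_weight n).aestronglyMeasurable hL.ne'
  have hma := aestronglyMeasurable_comp_dilation
    (continuous_fourier_of_integrable (memLp_one_iff_integrable.1 ha)).aestronglyMeasurable hc.ne'
  have hmb := aestronglyMeasurable_comp_dilation
    (Lp.aestronglyMeasurable (𝓕 (hb.toLp b) : Lp (α := Rn n) ℂ 2 volume)) hc.ne'
  have h1 : eLpNorm (fun ξ => weight n (L • ξ) • 𝓕 a ((2 * Real.pi)⁻¹ • ξ)) 2 volume ≤
      eLpNorm a 1 volume * eLpNorm (fun ξ => weight n (L • ξ)) 2 volume := by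
    refine eLpNorm_le_mul_eLpNorm_of_ae_le_mul'' _ hw (.of_forall fun ξ => ?_)
    rw [enorm_smul, mul_comm]
    gcongr
    exact enorm_fourier_le _ _
  have h2 : eLpNorm (fun ξ => weight n (L • ξ) •
      (𝓕 (hb.toLp b) : Lp (α := Rn n) ℂ 2 volume) ((2 * Real.pi)⁻¹ • ξ)) 2 volume ≤
      eLpNorm (fun ξ => (𝓕 (hb.toLp b) : Lp (α := Rn n) ℂ 2 volume) ((2 * Real.pi)⁻¹ • ξ))
        2 volume := by
    refine eLpNorm_mono fun ξ => ?_
    rw [norm_smul, Real.norm_of_nonneg (weight_nonneg _)]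
    exact mul_le_of_le_one_left (norm_nonneg _) (weight_le_one _)
  have h3 : eLpNorm (𝓕 (hb.toLp b) : Lp (α := Rn n) ℂ 2 volume) 2 volume = eLpNorm b 2 volume := by
    rw [← Lp.enorm_def, ← ofReal_norm, Lp.norm_fourier_eq, ofReal_norm, Lp.enorm_toLp]
  rw [eLpNorm_two_comp_dilation _ hc, h3] at h2
  rw [eLpNorm_two_comp_dilation _ hL] at h1
  calc _ = eLpNorm ((fun ξ => weight n (L • ξ) • 𝓕 a ((2 * Real.pi)⁻¹ • ξ)) + fun ξ =>
        weight n (L • ξ) • (𝓕 (hb.toLp b) : Lp (α := Rn n) ℂ 2 volume) ((2 * Real.pi)⁻¹ • ξ))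
        2 volume := by
        refine eLpNorm_congr_ae ?_
        filter_upwards [fourier_ae_eq_of_add hm hm' hf hab ha hb] with ξ h
        rw [h, smul_add]; rfl
    _ ≤ _ := (eLpNorm_add_le (hw.smul hma) (hw.smul hmb) (by norm_num)).trans (add_le_add h1 h2)
    _ = _ := by ring

end TripleDiffusion

namespace TripleDiffusion

/-! ### Interpolation between `L¹` and `L²` by truncation -/

theorem exists_add_of_memLp {n : ℕ} {f : Rn n → ℂ} {m l : ℝ} (hm : 1 ≤ m) (hm' : m ≤ 2)
    (hf : MemLp f (ENNReal.ofReal m) volume) (hl : 0 < l) :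
    ∃ a b : Rn n → ℂ, a + b = f ∧ MemLp a 1 volume ∧ MemLp b 2 volume ∧
      eLpNorm a 1 volume ≤
        ENNReal.ofReal (l ^ (1 - m)) * eLpNorm f (ENNReal.ofReal m) volume ^ m ∧
      eLpNorm b 2 volume ^ (2 : ℝ) ≤
        ENNReal.ofReal (l ^ (2 - m)) * eLpNorm f (ENNReal.ofReal m) volume ^ m := by
  have hm0 : 0 < m := by linarith
  have hN : eLpNorm f (ENNReal.ofReal m) volume ^ m = ∫⁻ x, ‖f x‖ₑ ^ m := by
    have := eLpNorm_nnreal_pow_eq_lintegral (f := f) (μ := (volume : Measure (Rn n)))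
      (p := m.toNNReal) (by simpa using hm0)
    rwa [Real.coe_toNNReal m hm0.le] at this
  have hfin : eLpNorm f (ENNReal.ofReal m) volume ^ m ≠ ⊤ :=
    ENNReal.rpow_ne_top_of_nonneg hm0.le hf.eLpNorm_ne_top
  have hset : NullMeasurableSet {x | l < ‖f x‖} (volume : Measure (Rn n)) :=
    nullMeasurableSet_lt aemeasurable_const hf.1.norm.aemeasurable
  have hpow (x : Rn n) : ‖f x‖ₑ ^ m = ENNReal.ofReal (‖f x‖ ^ m) := by
    rw [← ofReal_norm, ENNReal.ofReal_rpow_of_nonneg (norm_nonneg _) hm0.le]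
  let a : Rn n → ℂ := {x | l < ‖f x‖}.indicator f
  let b : Rn n → ℂ := {x | l < ‖f x‖}ᶜ.indicator f
  have ha : AEStronglyMeasurable a volume := hf.1.indicator₀ hset
  have hb : AEStronglyMeasurable b volume := hf.1.indicator₀ hset.compl
  have h1 : eLpNorm a 1 volume ≤
      ENNReal.ofReal (l ^ (1 - m)) * eLpNorm f (ENNReal.ofReal m) volume ^ m := by
    rw [hN, eLpNorm_one_eq_lintegral_enorm, ← lintegral_const_mul' _ _ ENNReal.ofReal_ne_top]
    refine lintegral_mono fun x => ?_
    by_cases hx : l < ‖f x‖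
    · have hx0 : 0 < ‖f x‖ := hl.trans hx
      have e : ‖f x‖ ≤ l ^ (1 - m) * ‖f x‖ ^ m := by
        calc ‖f x‖ = ‖f x‖ ^ (1 - m) * ‖f x‖ ^ m := by
              rw [← Real.rpow_add hx0, sub_add_cancel, Real.rpow_one]
          _ ≤ _ := by
              gcongr ?_ * _
              exact Real.rpow_le_rpow_of_nonpos hl hx.le (by linarith)
      rw [hpow, ← ENNReal.ofReal_mul (by positivity)]
      simp only [a, indicator_of_mem (show x ∈ {x | l < ‖f x‖} from hx)]
      rw [← ofReal_norm]
      exact ENNReal.ofReal_le_ofReal e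
    · simp [a, hx]
  have h2 : eLpNorm b 2 volume ^ (2 : ℝ) ≤
      ENNReal.ofReal (l ^ (2 - m)) * eLpNorm f (ENNReal.ofReal m) volume ^ m := by
    have := eLpNorm_nnreal_pow_eq_lintegral (f := b) (μ := (volume : Measure (Rn n)))
      (p := 2) (by norm_num)
    rw [NNReal.coe_ofNat, ENNReal.coe_ofNat] at this
    rw [this, hN, ← lintegral_const_mul' _ _ ENNReal.ofReal_ne_top]
    refine lintegral_mono fun x => ?_
    by_cases hx : l < ‖f x‖
    · simp [b, hx]
    · have e : ‖f x‖ ^ (2 : ℝ) ≤ l ^ (2 - m) * ‖f x‖ ^ m := by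
        rcases (norm_nonneg (f x)).eq_or_lt with h0 | h0
        · rw [← h0, Real.zero_rpow two_ne_zero]; positivity
        calc ‖f x‖ ^ (2 : ℝ) = ‖f x‖ ^ (2 - m) * ‖f x‖ ^ m := by
              rw [← Real.rpow_add h0, sub_add_cancel]
          _ ≤ _ := by
              gcongr ?_ * _
              exact Real.rpow_le_rpow h0.le (not_lt.1 hx) (by linarith)
      rw [hpow, ← ENNReal.ofReal_mul (by positivity)]
      simp only [b, indicator_of_mem (show x ∈ {x | l < ‖f x‖}ᶜ from hx)]
      rw [← ofReal_norm, ENNReal.ofReal_rpow_of_nonneg (norm_nonneg _) two_pos.le]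
      exact ENNReal.ofReal_le_ofReal e
  refine ⟨a, b, indicator_self_add_compl _ _, ⟨ha, h1.trans_lt ?_⟩, ⟨hb, ?_⟩, h1, h2⟩
  · exact ENNReal.mul_lt_top ENNReal.ofReal_lt_top hfin.lt_top
  · have := h2.trans_lt (ENNReal.mul_lt_top ENNReal.ofReal_lt_top hfin.lt_top)
    exact (ENNReal.rpow_lt_top_iff_of_pos two_pos).1 this

theorem exists_eLpNorm_weight_mul_fourier_le (n : ℕ) :
    ∃ C : ℝ, 0 < C ∧ ∀ (m L : ℝ) (f : Rn n → ℂ), 1 ≤ m → m ≤ 2 →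
      MemLp f (ENNReal.ofReal m) volume → 0 < L →
      eLpNorm (fun ξ => weight n (L • ξ) • fourier f ξ) 2 volume ≤
        ENNReal.ofReal (C * L ^ (-(n * (2 - m) / (2 * m)))) *
          eLpNorm f (ENNReal.ofReal m) volume := by
  set W := (eLpNorm (weight n) 2 volume).toReal with hW
  have hWe : eLpNorm (weight n) 2 volume = ENNReal.ofReal W :=
    (ENNReal.ofReal_toReal (memLp_weight n).eLpNorm_ne_top).symm
  have hW0 : 0 ≤ W := ENNReal.toReal_nonneg
  set P := (2 * Real.pi)⁻¹ ^ (-(n / 2 : ℝ)) with hP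
  have hP0 : 0 < P := by positivity
  refine ⟨W + P, by positivity, fun m L f hm hm' hf hL => ?_⟩
  have hm0 : 0 < m := by linarith
  set N := (eLpNorm f (ENNReal.ofReal m) volume).toReal with hN
  have hNe : eLpNorm f (ENNReal.ofReal m) volume = ENNReal.ofReal N :=
    (ENNReal.ofReal_toReal hf.eLpNorm_ne_top).symm
  have hN0 : 0 ≤ N := ENNReal.toReal_nonneg
  -- If `f` vanishes almost everywhere, the truncation height below would be zero, so the splitting
  -- `0 + f` is used instead.
  rcases hN0.eq_or_lt with h0 | h0
  · have hz : f =ᵐ[volume] 0 := by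
      rw [← eLpNorm_eq_zero_iff hf.1 (ENNReal.ofReal_pos.2 hm0).ne', hNe, ← h0, ENNReal.ofReal_zero]
    have hb : MemLp f 2 volume := (memLp_congr_ae hz).2 MemLp.zero
    have := eLpNorm_weight_mul_le hm hm' hf (zero_add f) MemLp.zero hb hL
    rw [eLpNorm_zero, mul_zero, zero_add, eLpNorm_congr_ae hz, eLpNorm_zero, mul_zero] at this
    exact this.trans zero_le
  -- This height balances the two contributions: `L^(-n/2) l^(1-m) N^m` and `(l^(2-m) N^m)^(1/2)`
  -- both equal `N L^(-n(2-m)/(2m))`.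
  set l := N * L ^ (-(n / m : ℝ)) with hl
  have hl0 : 0 < l := by positivity
  have hlp (q : ℝ) : l ^ q = N ^ q * L ^ (-(n / m : ℝ) * q) := by
    rw [hl, Real.mul_rpow h0.le (by positivity), ← Real.rpow_mul hL.le]
  obtain ⟨a, b, hab, ha, hb, h1, h2⟩ := exists_add_of_memLp hm hm' hf hl0
  have hNm : eLpNorm f (ENNReal.ofReal m) volume ^ m = ENNReal.ofReal (N ^ m) := by
    rw [hNe, ENNReal.ofReal_rpow_of_pos h0]
  rw [hNm, ← ENNReal.ofReal_mul (by positivity), hlp, mul_right_comm, ← Real.rpow_add h0] at h1 h2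
  have h2' : eLpNorm b 2 volume ≤ ENNReal.ofReal (N * L ^ (-(n * (2 - m) / (2 * m)))) := by
    rw [← ENNReal.rpow_le_rpow_iff two_pos]
    refine h2.trans (le_of_eq ?_)
    rw [ENNReal.ofReal_rpow_of_pos (by positivity), Real.mul_rpow h0.le (by positivity),
      ← Real.rpow_mul hL.le]
    have e : -(n / m : ℝ) * (2 - m) = -(n * (2 - m) / (2 * m)) * 2 := by field_simp
    rw [sub_add_cancel, e]
  refine (eLpNorm_weight_mul_le hm hm' hf hab ha hb hL).trans ?_
  calc _ ≤ ENNReal.ofReal (L ^ (-(n / 2 : ℝ))) * ENNReal.ofReal W *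
          ENNReal.ofReal (N ^ (1 - m + m) * L ^ (-(n / m : ℝ) * (1 - m))) +
        ENNReal.ofReal P * ENNReal.ofReal (N * L ^ (-(n * (2 - m) / (2 * m)))) := by
        rw [hWe]; gcongr
    _ = _ := by
        rw [hNe, ← ENNReal.ofReal_mul (by positivity), ← ENNReal.ofReal_mul (by positivity),
          ← ENNReal.ofReal_mul (by positivity), ← ENNReal.ofReal_mul (by positivity),
          ← ENNReal.ofReal_add (by positivity) (by positivity)]
        congr 1
        have e : L ^ (-(n * (2 - m) / (2 * m))) = L ^ (-(n / 2 : ℝ)) *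
            L ^ (-(n / m : ℝ) * (1 - m)) := by
          rw [← Real.rpow_add hL]; congr 1; field_simp; ring
        rw [e, sub_add_cancel, Real.rpow_one]; ring

/-! ### Decay of the low-frequency symbol -/

/-- Raise `y ≤ exp y` to the power `q` at `y = x/(2q)`. -/
theorem rpow_le_mul_exp_half {q x : ℝ} (hq : 0 < q) (hx : 0 ≤ x) :
    x ^ q ≤ (2 * q) ^ q * Real.exp (x / 2) := by
  have h1 : x / (2 * q) ≤ Real.exp (x / (2 * q)) := by
    linarith [Real.add_one_le_exp (x / (2 * q))]
  have h2 : (x / (2 * q)) ^ q ≤ Real.exp (x / 2) := by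
    calc _ ≤ Real.exp (x / (2 * q)) ^ q := by gcongr
      _ = _ := by rw [← Real.exp_mul]; congr 1; field_simp
  rw [Real.div_rpow hx (by positivity), div_le_iff₀ (by positivity)] at h2
  linarith

/-- With `R = (1+t)^(1/p) ‖ξ‖`, one has `t‖ξ‖^p = R^p - ‖ξ‖^p ≥ R^p - ε^p`. Thus replacing `t` by
`1+t` costs only a constant on the ball, and a function of `R` remains that decays faster than the
weight. -/
theorem exists_symbol_le (n : ℕ) {k p ε : ℝ} (hk : 0 ≤ k) (hp : 1 ≤ p) :
    ∃ C : ℝ, 0 < C ∧ ∀ (t : ℝ) (ξ : Rn n), 0 ≤ t → ‖ξ‖ ≤ ε →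
      ‖ξ‖ ^ k * Real.exp (-(t * ‖ξ‖ ^ p / 2)) ≤
        C * (1 + t) ^ (-(k / p)) * weight n ((1 + t) ^ p⁻¹ • ξ) := by
  have hp0 : 0 < p := by linarith
  have hq : 0 < k + (n + 1 : ℝ) := by positivity
  refine ⟨Real.exp (ε ^ p / 2) * (Real.exp 1 * (2 * (k + (n + 1 : ℝ))) ^ (k + (n + 1 : ℝ))),
    by positivity, fun t ξ ht hξ => ?_⟩
  set r := ‖ξ‖ with hr
  have hr0 : 0 ≤ r := norm_nonneg ξ
  have ht1 : 0 < 1 + t := by linarith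
  set L := (1 + t) ^ p⁻¹ with hL
  have hL0 : 0 < L := by positivity
  have hLp : L ^ p = 1 + t := by
    rw [hL, ← Real.rpow_mul ht1.le, inv_mul_cancel₀ hp0.ne', Real.rpow_one]
  have hRp : (L * r) ^ p = (1 + t) * r ^ p := by rw [Real.mul_rpow hL0.le hr0, hLp]
  have hrk : r ^ k = (1 + t) ^ (-(k / p)) * (L * r) ^ k := by
    rw [Real.mul_rpow hL0.le hr0, hL, ← Real.rpow_mul ht1.le, ← mul_assoc, ← Real.rpow_add ht1]
    have : -(k / p) + p⁻¹ * k = 0 := by field_simp; ring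
    rw [this, Real.rpow_zero, one_mul]
  have hw : weight n (L • ξ) = ((1 + L * r) ^ (n + 1 : ℝ))⁻¹ := by
    rw [weight, norm_smul, Real.norm_of_nonneg hL0.le, Real.rpow_neg (by positivity)]
  set R := L * r with hR
  have hR0 : 0 ≤ R := by positivity
  -- Decay in `exp(-R/2)` suffices; writing it through `1 + R` produces the factor `exp 1`.
  have hge : R - 1 ≤ R ^ p := by
    rcases le_total R 1 with h | h
    · exact (by linarith : R - 1 ≤ 0).trans (by positivity)
    · have := Real.rpow_le_rpow_of_exponent_le h hp
      rw [Real.rpow_one] at this; linarith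
  have hexp : Real.exp (-(t * r ^ p / 2)) ≤
      Real.exp (ε ^ p / 2) * (Real.exp 1 * Real.exp (-((1 + R) / 2))) := by
    rw [← Real.exp_add, ← Real.exp_add]
    refine Real.exp_le_exp.2 ?_
    have : r ^ p ≤ ε ^ p := Real.rpow_le_rpow hr0 hξ hp0.le
    rw [hRp] at hge
    linarith
  have hpoly : R ^ k * (1 + R) ^ (n + 1 : ℝ) ≤
      (2 * (k + (n + 1 : ℝ))) ^ (k + (n + 1 : ℝ)) * Real.exp ((1 + R) / 2) := by
    refine le_trans ?_ (rpow_le_mul_exp_half hq (by positivity))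
    rw [Real.rpow_add (by positivity) k]
    gcongr
    linarith
  rw [hw, hrk, ← div_eq_mul_inv, le_div_iff₀ (by positivity)]
  calc _ = (1 + t) ^ (-(k / p)) * (R ^ k * (1 + R) ^ (n + 1 : ℝ)) *
        Real.exp (-(t * r ^ p / 2)) := by ring
    _ ≤ (1 + t) ^ (-(k / p)) * ((2 * (k + (n + 1 : ℝ))) ^ (k + (n + 1 : ℝ)) *
        Real.exp ((1 + R) / 2)) *
        (Real.exp (ε ^ p / 2) * (Real.exp 1 * Real.exp (-((1 + R) / 2)))) := by gcongr
    _ = _ := by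
        rw [Real.exp_neg ((1 + R) / 2)]
        field_simp

end TripleDiffusion

namespace TripleDiffusion

/-! ### The difference of the solutions -/

section Pointwise

open scoped Matrix.Norms.Operator

theorem norm_toLp_le (v : Fin 3 → ℂ) : ‖(WithLp.toLp 2 v : C3)‖ ≤ 3 * ‖v‖ := by
  rw [EuclideanSpace.norm_eq, Real.sqrt_le_left (by positivity), Fin.sum_univ_three]
  have h (i : Fin 3) : ‖v i‖ ^ 2 ≤ ‖v‖ ^ 2 := by gcongr; exact norm_le_pi_norm v i
  have := h 0
  have := h 1
  have := h 2
  change ‖v 0‖ ^ 2 + ‖v 1‖ ^ 2 + ‖v 2‖ ^ 2 ≤ _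
  nlinarith [norm_nonneg v]

theorem norm_initialDatum_le {n : ℕ} (v u θ : Rn n → ℂ) (ξ : Rn n) :
    ‖initialDatum v u θ ξ‖ ≤ ‖fourier v ξ‖ + ‖fourier u ξ‖ + ‖fourier θ ξ‖ := by
  have h1 := norm_add_le (fourier u ξ) (fourier v ξ)
  have h2 := norm_sub_le (fourier u ξ) (fourier v ξ)
  have h3 := norm_nonneg (fourier u ξ)
  have h4 := norm_nonneg (fourier v ξ)
  have h5 := norm_nonneg (fourier θ ξ)
  rw [pi_norm_le_iff_of_nonneg (by positivity)]
  intro i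
  fin_cases i <;> simp [initialDatum] <;> linarith

theorem cutDifference_ae_eq {n : ℕ} {σ ε t : ℝ} {χ : Rn n → ℝ} {w₀ : Rn n → Fin 3 → ℂ}
    {w w' : ℝ → Rn n → Fin 3 → ℂ} (hχ : tsupport χ ⊆ closedBall 0 ε)
    (hw : SolvesCauchy univ (fun ξ => A σ ‖ξ‖) w₀ w)
    (hw' : SolvesCauchy (closedBall 0 ε) (fun ξ => refSymbol σ ‖ξ‖) (refDatum σ w₀) w')
    (ht : 0 ≤ t) :
    cutDifference σ χ w w' t =ᵐ[volume] fun ξ =>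
      WithLp.toLp 2 ((χ ξ : ℂ) • (propagatorDiff σ t ‖ξ‖ *ᵥ w₀ ξ)) := by
  filter_upwards [hw, hw'] with ξ h h'
  by_cases hξ : ξ ∈ closedBall (0 : Rn n) ε
  · obtain ⟨h0, hc, hd⟩ := h (mem_univ _)
    obtain ⟨h0', hc', hd'⟩ := h' hξ
    have e := eq_exp_mulVec_of_hasDerivAt hc hd ht
    have e' := eq_exp_mulVec_of_hasDerivAt hc' hd' ht
    rw [cutDifference, e, e', h0, h0', propagatorDiff, refDatum, Matrix.sub_mulVec,
      Matrix.mulVec_mulVec, Matrix.mulVec_mulVec]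
  -- Outside the ball the reference solution is unconstrained, but the cutoff removes it.
  · have : χ ξ = 0 := image_eq_zero_of_notMem_tsupport fun hx => hξ (hχ hx)
    simp [cutDifference, this]

theorem aestronglyMeasurable_propagatorDiff_mulVec {n : ℕ} {σ t : ℝ} {χ : Rn n → ℝ}
    (hχ : Continuous χ) {v u θ : Rn n → ℂ} (hv : AEStronglyMeasurable (fourier v) volume)
    (hu : AEStronglyMeasurable (fourier u) volume)
    (hθ : AEStronglyMeasurable (fourier θ) volume) :
    AEStronglyMeasurable (fun ξ => (WithLp.toLp 2 ((χ ξ : ℂ) •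
      (propagatorDiff σ t ‖ξ‖ *ᵥ initialDatum v u θ ξ)) : C3)) volume := by
  have h0 : AEStronglyMeasurable (initialDatum v u θ) volume := by
    refine (aemeasurable_pi_iff.2 fun i => ?_).aestronglyMeasurable
    fin_cases i
    · exact (hu.add hv).aemeasurable
    · exact (hu.sub hv).aemeasurable
    · exact hθ.aemeasurable
  have hP : StronglyMeasurable fun ξ : Rn n => propagatorDiff σ t ‖ξ‖ :=
    (stronglyMeasurable_propagatorDiff σ t).comp_measurable measurable_norm
  have hPv : AEStronglyMeasurable
      (fun ξ => mulVecCLM (propagatorDiff σ t ‖ξ‖) (initialDatum v u θ ξ)) volume :=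
    mulVecCLM.aestronglyMeasurable_comp₂ hP.aestronglyMeasurable h0
  have hχ' : AEStronglyMeasurable (fun ξ => (χ ξ : ℂ)) volume :=
    (Complex.continuous_ofReal.comp hχ).aestronglyMeasurable
  have hmul : AEStronglyMeasurable (fun ξ => (χ ξ : ℂ) •
      (propagatorDiff σ t ‖ξ‖ *ᵥ initialDatum v u θ ξ)) volume := hχ'.smul hPv
  exact (PiLp.continuous_toLp 2 _).comp_aestronglyMeasurable hmul

end Pointwise

theorem homSobolevNorm_fourierInvL2 {n : ℕ} (s : ℝ) {h : Rn n → C3} (hh : MemLp h 2 volume) :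
    homSobolevNorm s (fourierInvL2 h hh) =
      ENNReal.ofReal ((2 * Real.pi) ^ (-(n / 2 : ℝ))) *
        eLpNorm (fun ξ => ‖ξ‖ ^ s • h ξ) 2 volume := by
  have hc : 0 < 2 * Real.pi := by positivity
  rw [← eLpNorm_two_comp_dilation _ hc, homSobolevNorm, fourierInvL2,
    FourierTransform.fourier_fourierInv_eq]
  refine eLpNorm_congr_ae ?_
  filter_upwards [(memLp_comp_dilation hh).coeFn_toLp] with η hη
  rw [hη, norm_smul, Real.norm_of_nonneg hc.le]

end TripleDiffusion

namespace TripleDiffusion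

section Pointwise

open scoped Matrix.Norms.Operator

theorem exists_norm_cut_le {n : ℕ} {σ ε s : ℝ} {χ : Rn n → ℝ} (hσ1 : σ < 1)
    (hε' : ε ^ (2 - 2 * σ) ≤ 1 / 16) (hχc : Continuous χ)
    (hχ : tsupport χ ⊆ closedBall 0 ε) (hs : 0 ≤ s) :
    ∃ C : ℝ, 0 < C ∧ ∀ (t : ℝ) (ξ : Rn n) (v : Fin 3 → ℂ), 0 ≤ t → ξ ≠ 0 →
      ‖‖ξ‖ ^ s • (WithLp.toLp 2 ((χ ξ : ℂ) • (propagatorDiff σ t ‖ξ‖ *ᵥ v)) : C3)‖ ≤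
        C * (1 + t) ^ (-((s + (2 - 2 * σ)) / (4 - 2 * σ))) *
          weight n ((1 + t) ^ (4 - 2 * σ)⁻¹ • ξ) * ‖v‖ := by
  have hcs : HasCompactSupport χ := (isCompact_closedBall 0 ε).of_isClosed_subset
    (isClosed_tsupport χ) hχ
  obtain ⟨M, hM⟩ := hcs.exists_bound_of_continuous hχc
  have hM0 : 0 ≤ M := (norm_nonneg _).trans (hM 0)
  obtain ⟨C, hC, hsym⟩ := exists_symbol_le n (k := s + (2 - 2 * σ)) (p := 4 - 2 * σ) (ε := ε)
    (by linarith) (by linarith)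
  set K := ‖T₀‖ * ‖T₀⁻¹‖ * 240 with hK
  have hK0 : 0 ≤ K := by positivity
  -- The factor `3` pays for the change from the sup norm to the Hermitian norm; the added ones keep
  -- the constant positive when `M` or `K` is zero.
  refine ⟨3 * (M + 1) * (K + 1) * C, by positivity, fun t ξ v ht hξ => ?_⟩
  have hr : 0 < ‖ξ‖ := norm_pos_iff.2 hξ
  have ht1 : 0 < 1 + t := by linarith
  by_cases hξε : ‖ξ‖ ≤ ε
  · have hδ : ‖ξ‖ ^ (2 - 2 * σ) ≤ 1 / 16 :=
      (Real.rpow_le_rpow hr.le hξε (by linarith)).trans hε'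
    have h1 := norm_propagatorDiff_le hr hδ ht
    have h2 := hsym t ξ ht hξε
    rw [Real.rpow_add hr] at h2
    rw [norm_smul, Real.norm_of_nonneg (by positivity)]
    have hw := weight_nonneg ((1 + t) ^ (4 - 2 * σ)⁻¹ • ξ)
    calc _ ≤ ‖ξ‖ ^ s * (3 * ((M + 1) * (((K + 1) * (‖ξ‖ ^ (2 - 2 * σ) *
          Real.exp (-(t * ‖ξ‖ ^ (4 - 2 * σ) / 2)))) * ‖v‖))) := by
          gcongr
          refine (norm_toLp_le _).trans ?_
          rw [norm_smul]
          gcongr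
          · rw [Complex.norm_real]; linarith [hM ξ]
          · refine (Matrix.linfty_opNorm_mulVec _ _).trans ?_
            gcongr
            refine h1.trans ?_
            gcongr
            linarith
      _ = 3 * (M + 1) * (K + 1) * (‖ξ‖ ^ s * ‖ξ‖ ^ (2 - 2 * σ) *
          Real.exp (-(t * ‖ξ‖ ^ (4 - 2 * σ) / 2))) * ‖v‖ := by ring
      _ ≤ 3 * (M + 1) * (K + 1) * (C * (1 + t) ^ (-((s + (2 - 2 * σ)) / (4 - 2 * σ))) *
          weight n ((1 + t) ^ (4 - 2 * σ)⁻¹ • ξ)) * ‖v‖ := by gcongr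
      _ = _ := by ring
  · have : χ ξ = 0 := image_eq_zero_of_notMem_tsupport fun hx => hξε (by simpa using hχ hx)
    have hw := weight_nonneg ((1 + t) ^ (4 - 2 * σ)⁻¹ • ξ)
    simp only [this, Complex.ofReal_zero, zero_smul, WithLp.toLp_zero, smul_zero, norm_zero]
    positivity

end Pointwise

theorem exists_eLpNorm_cutDifference_le {n : ℕ} (hn : 1 ≤ n) {σ ε s m : ℝ} {χ : Rn n → ℝ}
    (hσ1 : σ < 1) (hε' : ε ^ (2 - 2 * σ) ≤ 1 / 16) (hχc : Continuous χ)
    (hχ : tsupport χ ⊆ closedBall 0 ε) (hs : 0 ≤ s) (hm : 1 ≤ m) (hm' : m ≤ 2) :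
    ∃ C : ℝ, 0 < C ∧ ∀ v u θ : Rn n → ℂ, MemLp v (ENNReal.ofReal m) volume →
      MemLp u (ENNReal.ofReal m) volume → MemLp θ (ENNReal.ofReal m) volume →
      ∀ w w' : ℝ → Rn n → Fin 3 → ℂ,
        SolvesCauchy univ (fun ξ => A σ ‖ξ‖) (initialDatum v u θ) w →
        SolvesCauchy (closedBall 0 ε) (fun ξ => refSymbol σ ‖ξ‖)
          (refDatum σ (initialDatum v u θ)) w' →
      ∀ t : ℝ, 0 ≤ t →
        eLpNorm (fun ξ => ‖ξ‖ ^ s • cutDifference σ χ w w' t ξ) 2 volume ≤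
          ENNReal.ofReal (C * (1 + t) ^ (-(((2 - m) * n + 2 * m * s) / (4 * m * (2 - σ)))
            - (1 - σ) / (2 - σ))) *
          (eLpNorm v (ENNReal.ofReal m) volume + eLpNorm u (ENNReal.ofReal m) volume +
            eLpNorm θ (ENNReal.ofReal m) volume) := by
  obtain ⟨B, hB, hcut⟩ := exists_norm_cut_le hσ1 hε' hχc hχ hs
  obtain ⟨D, hD, hfou⟩ := exists_eLpNorm_weight_mul_fourier_le n
  refine ⟨B * D, by positivity, fun v u θ hv hu hθ w w' hw hw' t ht => ?_⟩
  -- In positive dimension the origin is a null set, so the excluded frequency `ξ = 0` does no harm.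
  have : Nonempty (Fin n) := ⟨⟨0, hn⟩⟩
  have ht1 : 0 < 1 + t := by linarith
  set L := (1 + t) ^ (4 - 2 * σ)⁻¹ with hL
  have hL0 : 0 < L := by positivity
  set b := (1 + t) ^ (-((s + (2 - 2 * σ)) / (4 - 2 * σ))) with hb
  let G (f : Rn n → ℂ) (ξ : Rn n) : ℝ := ‖weight n (L • ξ) • fourier f ξ‖
  have hG (f : Rn n → ℂ) (hf : MemLp f (ENNReal.ofReal m) volume) :
      AEStronglyMeasurable (G f) volume :=
    ((aestronglyMeasurable_comp_dilation (measurable_weight n).aestronglyMeasurable hL0.ne').smul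
      (aestronglyMeasurable_fourier hm hm' hf)).norm
  have hGn (f : Rn n → ℂ) (hf : MemLp f (ENNReal.ofReal m) volume) :
      eLpNorm (G f) 2 volume ≤ ENNReal.ofReal (D * L ^ (-(n * (2 - m) / (2 * m)))) *
        eLpNorm f (ENNReal.ofReal m) volume := by
    rw [eLpNorm_norm]; exact hfou m L f hm hm' hf hL0
  have hpt : ∀ᵐ ξ : Rn n, ‖‖ξ‖ ^ s • cutDifference σ χ w w' t ξ‖ ≤
      B * b * ‖(G v + G u + G θ) ξ‖ := by
    filter_upwards [cutDifference_ae_eq hχ hw hw' ht, Measure.ae_ne volume (0 : Rn n)] with ξ h hξ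
    rw [h]
    refine (hcut t ξ _ ht hξ).trans ?_
    have hw0 := weight_nonneg (L • ξ)
    have e : ‖(G v + G u + G θ) ξ‖ =
        weight n (L • ξ) * (‖fourier v ξ‖ + ‖fourier u ξ‖ + ‖fourier θ ξ‖) := by
      simp only [G, Pi.add_apply, norm_smul, Real.norm_of_nonneg hw0]
      rw [Real.norm_of_nonneg (by positivity)]; ring
    rw [e, ← mul_assoc]
    gcongr
    exact norm_initialDatum_le v u θ ξ
  refine (eLpNorm_le_mul_eLpNorm_of_ae_le_mul hpt 2).trans ?_
  have hexp : B * b * (D * L ^ (-(n * (2 - m) / (2 * m)))) =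
      B * D * (1 + t) ^ (-(((2 - m) * n + 2 * m * s) / (4 * m * (2 - σ)))
        - (1 - σ) / (2 - σ)) := by
    have e : b * L ^ (-(n * (2 - m) / (2 * m))) =
        (1 + t) ^ (-(((2 - m) * n + 2 * m * s) / (4 * m * (2 - σ))) - (1 - σ) / (2 - σ)) := by
      rw [hb, hL, ← Real.rpow_mul ht1.le, ← Real.rpow_add ht1]
      congr 1
      have h1 : 4 - 2 * σ = 2 * (2 - σ) := by ring
      have h2 : 2 - σ ≠ 0 := by linarith
      have h3 : m ≠ 0 := by linarith
      rw [h1]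
      field_simp
      ring
    rw [← e]; ring
  calc _ ≤ ENNReal.ofReal (B * b) *
        (ENNReal.ofReal (D * L ^ (-(n * (2 - m) / (2 * m)))) *
            eLpNorm v (ENNReal.ofReal m) volume +
          ENNReal.ofReal (D * L ^ (-(n * (2 - m) / (2 * m)))) *
            eLpNorm u (ENNReal.ofReal m) volume +
          ENNReal.ofReal (D * L ^ (-(n * (2 - m) / (2 * m)))) *
            eLpNorm θ (ENNReal.ofReal m) volume) := by
        gcongr
        refine (eLpNorm_add_le ((hG v hv).add (hG u hu)) (hG θ hθ) (by norm_num)).trans ?_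
        exact add_le_add ((eLpNorm_add_le (hG v hv) (hG u hu) (by norm_num)).trans
          (add_le_add (hGn v hv) (hGn u hu))) (hGn θ hθ)
    _ = _ := by
        rw [← mul_add, ← mul_add, ← mul_assoc, ← ENNReal.ofReal_mul (by positivity), hexp]

end TripleDiffusion

theorem mainTheorem10 (σ : ℝ) (hσ0 : 0 ≤ σ) (hσ1 : σ < 1) :
    ∃ ε₀ : ℝ, 0 < ε₀ ∧
      (∀ r : ℝ, 0 ≤ r → r ≤ ε₀ →
        IsUnit TripleDiffusion.T₀ ∧ IsUnit (TripleDiffusion.T₁ σ r) ∧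
          IsUnit (TripleDiffusion.T₁half σ r)) ∧
      ∀ n : ℕ, 1 ≤ n →
      ∀ ε : ℝ, 0 < ε → ε ≤ ε₀ →
      ∀ χ : TripleDiffusion.Rn n → ℝ, ContDiff ℝ ∞ χ → tsupport χ ⊆ closedBall 0 ε →
      ∀ m s : ℝ, 1 ≤ m → m ≤ 2 → 0 ≤ s →
      ∃ C : ℝ, 0 < C ∧
        ∀ (u₀ : 𝓢'(TripleDiffusion.Rn n, ℂ)) (v₀ u₁ θ₀ : TripleDiffusion.Rn n → ℂ),
          TripleDiffusion.IsAbsDSq u₀ v₀ →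
          MemLp v₀ (ENNReal.ofReal m) volume →
          MemLp u₁ (ENNReal.ofReal m) volume →
          MemLp θ₀ (ENNReal.ofReal m) volume →
        ∀ w w' : ℝ → TripleDiffusion.Rn n → Fin 3 → ℂ,
          TripleDiffusion.SolvesCauchy univ (fun ξ => TripleDiffusion.A σ ‖ξ‖)
            (TripleDiffusion.initialDatum v₀ u₁ θ₀) w →
          TripleDiffusion.SolvesCauchy (closedBall 0 ε)
            (fun ξ => TripleDiffusion.refSymbol σ ‖ξ‖)
            (TripleDiffusion.refDatum σ (TripleDiffusion.initialDatum v₀ u₁ θ₀)) w' →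
        ∀ t : ℝ, 0 ≤ t →
          ∃ h : MemLp (TripleDiffusion.cutDifference σ χ w w' t) 2 volume,
            TripleDiffusion.homSobolevNorm s
                (TripleDiffusion.fourierInvL2 (TripleDiffusion.cutDifference σ χ w w' t) h) ≤
              ENNReal.ofReal
                  (C * (1 + t) ^ (-(((2 - m) * n + 2 * m * s) / (4 * m * (2 - σ)))
                    - (1 - σ) / (2 - σ))) *
                (eLpNorm v₀ (ENNReal.ofReal m) volume + eLpNorm u₁ (ENNReal.ofReal m) volume +
                  eLpNorm θ₀ (ENNReal.ofReal m) volume) := by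
  have hσ : 2 - 2 * σ ≠ 0 := by linarith
  have hpow : ∀ r : ℝ, 0 ≤ r → r ≤ (1 / 16 : ℝ) ^ (2 - 2 * σ)⁻¹ → r ^ (2 - 2 * σ) ≤ 1 / 16 := by
    intro r h0 h
    calc _ ≤ ((1 / 16 : ℝ) ^ (2 - 2 * σ)⁻¹) ^ (2 - 2 * σ) :=
          Real.rpow_le_rpow h0 h (by linarith)
      _ = _ := Real.rpow_inv_rpow (by norm_num) hσ
  -- Chosen so that `r ≤ ε₀` forces `δ = r^(2-2σ) ≤ 1/16`.
  refine ⟨(1 / 16 : ℝ) ^ (2 - 2 * σ)⁻¹, by positivity, fun r h0 h =>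
    ⟨TripleDiffusion.isUnit_T₀, TripleDiffusion.isUnit_T₁ h0 (hpow r h0 h),
      TripleDiffusion.isUnit_T₁half h0 (hpow r h0 h)⟩, ?_⟩
  intro n hn ε hε hε₀ χ hχ hsupp m s hm hm' hs
  have hε' := hpow ε hε.le hε₀
  -- The case `s = 0` supplies membership in `L²`, needed before the inverse transform can be
  -- formed.
  obtain ⟨C₀, -, h₀⟩ := TripleDiffusion.exists_eLpNorm_cutDifference_le hn hσ1 hε'
    hχ.continuous hsupp le_rfl hm hm'
  obtain ⟨C, hC, hb⟩ := TripleDiffusion.exists_eLpNorm_cutDifference_le hn hσ1 hε'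
    hχ.continuous hsupp hs hm hm'
  refine ⟨(2 * Real.pi) ^ (-(n / 2 : ℝ)) * C, by positivity, ?_⟩
  intro u₀ v₀ u₁ θ₀ _ hv hu hθ w w' hw hw' t ht
  have hmem : MemLp (TripleDiffusion.cutDifference σ χ w w' t) 2 volume := by
    refine ⟨(TripleDiffusion.aestronglyMeasurable_propagatorDiff_mulVec hχ.continuous
      (TripleDiffusion.aestronglyMeasurable_fourier hm hm' hv)
      (TripleDiffusion.aestronglyMeasurable_fourier hm hm' hu)
      (TripleDiffusion.aestronglyMeasurable_fourier hm hm' hθ)).congr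
      (TripleDiffusion.cutDifference_ae_eq hsupp hw hw' ht).symm, ?_⟩
    have := h₀ v₀ u₁ θ₀ hv hu hθ w w' hw hw' t ht
    simp only [Real.rpow_zero, one_smul] at this
    exact this.trans_lt (ENNReal.mul_lt_top ENNReal.ofReal_lt_top (ENNReal.add_lt_top.2
      ⟨ENNReal.add_lt_top.2 ⟨hv.2, hu.2⟩, hθ.2⟩))
  refine ⟨hmem, ?_⟩
  rw [TripleDiffusion.homSobolevNorm_fourierInvL2, mul_assoc,
    ENNReal.ofReal_mul (p := (2 * Real.pi) ^ (-(n / 2 : ℝ))) (by positivity), mul_assoc]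
  gcongr
  exact hb v₀ u₁ θ₀ hv hu hθ w w' hw hw' t ht
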